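/- Let $n\ge 0$. A polyhedron in $\mathbb{R}^n$ is the solution set of a finite system of linear inequalities; it is rational if the system can be chosen with rational entries. Let $\mathbf 1$ be the all-ones vector and $x\vee y$, $x\wedge y$ the componentwise maximum and minimum. A polyhedron $P\subseteq\mathbb{R}^n$ is L-convex if $x,y\in P$ implies $x\vee y,\ x\wedge y\in P$, and $x\in P$, $\mu\in\mathbb{R}$ implies $x+\mu\mathbf 1\in P$; it is L$^\natural$-convex if $P=\{x\in\mathbb{R}^n : (x,0)\in Q\}$ for some L-convex polyhedron $Q\subseteq\mathbb{R}^{n+1}$. A polyhedron is L$_2$-convex (resp. L$_2^\natural$-convex) if it is the Minkowski sum of two L-convex (resp. L$^\natural$-convex) polyhedra. A nonempty set $S\subseteq\mathbb{Z}^n$ is L-convex if $x,y\in S$ implies $x\vee y,\ x\wedge y\in S$, and $x\in S$, $\mu\in\mathbb{Z}$ implies $x+\mu\mathbf 1\in S$; an L$_2$-convex set is the Minkowski sum of two L-convex sets. A system $Ax\le b$ with rational $A$, $b$ is totally dual integral (TDI) if, for every integral vector $w$ for which $\min\{y^\top b : y^\top A=w^\top,\ y\ge 0\}$ is finite, this minimum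 is attained by an integral vector $y$. The system is box-TDI if the system $[Ax\le b,\ d\le x\le c]$ is TDI for all rational vectors $c,d\in\mathbb{Q}^n$. A polyhedron is a box-TDI polyhedron if it can be described by a box-TDI system. Theorem 3.3. (1) Every rational L$_2^\natural$-convex polyhedron is a box-TDI polyhedron. (2) Every L$_2$-convex polyhedron is L$_2^\natural$-convex; in particular, every rational L$_2$-convex polyhedron is a box-TDI polyhedron. (3) The convex hull of an L$_2$-convex set is an L$_2$-convex polyhedron and a box-TDI polyhedron. -/

import Mathlib

open scoped Pointwise

/-- The solution set in `ℝⁿ` of a finite system `A x ≤ b` of linear inequalities. -/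
def solutionSet {m n : ℕ} (A : Matrix (Fin m) (Fin n) ℝ) (b : Fin m → ℝ) :
    Set (Fin n → ℝ) :=
  {x | ∀ i, (A.mulVec x) i ≤ b i}

/-- A polyhedron: the solution set of a finite system of linear inequalities. -/
def IsPolyhedron {n : ℕ} (P : Set (Fin n → ℝ)) : Prop :=
  ∃ (m : ℕ) (A : Matrix (Fin m) (Fin n) ℝ) (b : Fin m → ℝ), P = solutionSet A b

/-- The solution set in `ℝⁿ` of a finite system `A x ≤ b` with rational entries. -/
def ratSolutionSet {m n : ℕ} (A : Matrix (Fin m) (Fin n) ℚ) (b : Fin m → ℚ) :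
    Set (Fin n → ℝ) :=
  solutionSet (A.map (fun q : ℚ => (q : ℝ))) (fun i => (b i : ℝ))

/-- A rational polyhedron: the solution set of a finite system with rational entries. -/
def IsRationalPolyhedron {n : ℕ} (P : Set (Fin n → ℝ)) : Prop :=
  ∃ (m : ℕ) (A : Matrix (Fin m) (Fin n) ℚ) (b : Fin m → ℚ), P = ratSolutionSet A b

/-! ### L-convexity.  `x ⊔ y` and `x ⊓ y` are the componentwise maximum and minimum. -/

/-- L-convex sets of integer vectors. -/
def IsLConvexSet {n : ℕ} (S : Set (Fin n → ℤ)) : Prop :=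
  S.Nonempty ∧
  (∀ x ∈ S, ∀ y ∈ S, x ⊔ y ∈ S ∧ x ⊓ y ∈ S) ∧
  (∀ x ∈ S, ∀ μ : ℤ, (fun i => x i + μ) ∈ S)

/-- L₂-convex sets: Minkowski sums of two L-convex sets. -/
def IsL2ConvexSet {n : ℕ} (S : Set (Fin n → ℤ)) : Prop :=
  ∃ S₁ S₂ : Set (Fin n → ℤ), IsLConvexSet S₁ ∧ IsLConvexSet S₂ ∧ S = S₁ + S₂

/-- L-convex polyhedra. -/
def IsLConvexPolyhedron {n : ℕ} (P : Set (Fin n → ℝ)) : Prop :=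
  IsPolyhedron P ∧
  (∀ x ∈ P, ∀ y ∈ P, x ⊔ y ∈ P ∧ x ⊓ y ∈ P) ∧
  (∀ x ∈ P, ∀ μ : ℝ, (fun i => x i + μ) ∈ P)

/-- L♮-convex polyhedra: `P = {x | (x, 0) ∈ Q}` for an L-convex polyhedron `Q ⊆ ℝⁿ⁺¹`. -/
def IsLNatConvexPolyhedron {n : ℕ} (P : Set (Fin n → ℝ)) : Prop :=
  IsPolyhedron P ∧
  ∃ Q : Set (Fin (n + 1) → ℝ), IsLConvexPolyhedron Q ∧
    P = {x | (Fin.snoc x 0 : Fin (n + 1) → ℝ) ∈ Q}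

/-- L₂-convex polyhedra: Minkowski sums of two L-convex polyhedra. -/
def IsL2ConvexPolyhedron {n : ℕ} (P : Set (Fin n → ℝ)) : Prop :=
  IsPolyhedron P ∧
  ∃ P₁ P₂ : Set (Fin n → ℝ),
    IsLConvexPolyhedron P₁ ∧ IsLConvexPolyhedron P₂ ∧ P = P₁ + P₂

/-- L₂♮-convex polyhedra: Minkowski sums of two L♮-convex polyhedra. -/
def IsL2NatConvexPolyhedron {n : ℕ} (P : Set (Fin n → ℝ)) : Prop :=
  IsPolyhedron P ∧
  ∃ P₁ P₂ : Set (Fin n → ℝ),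
    IsLNatConvexPolyhedron P₁ ∧ IsLNatConvexPolyhedron P₂ ∧ P = P₁ + P₂

/-- The convex hull in `ℝⁿ` of a set of integer vectors. -/
def integerHull {n : ℕ} (S : Set (Fin n → ℤ)) : Set (Fin n → ℝ) :=
  convexHull ℝ ((fun (x : Fin n → ℤ) (i : Fin n) => (x i : ℝ)) '' S)

/-! ### Total dual integrality -/

/-- Feasibility of the real vector `y` in the dual program
`min {yᵀ b | yᵀ A = wᵀ, y ≥ 0}` of `max {wᵀ x | A x ≤ b}`. -/
def IsDualFeasible {ι : Type} [Fintype ι] {n : ℕ} (A : Matrix ι (Fin n) ℚ)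
    (w : Fin n → ℤ) (y : ι → ℝ) : Prop :=
  (∀ i, 0 ≤ y i) ∧ ∀ j, ∑ i, y i * (A i j : ℝ) = (w j : ℝ)

/-- Optimality of the real vector `y` in the program `min {yᵀ b | yᵀ A = wᵀ, y ≥ 0}`. -/
def IsDualOptimal {ι : Type} [Fintype ι] {n : ℕ} (A : Matrix ι (Fin n) ℚ)
    (b : ι → ℚ) (w : Fin n → ℤ) (y : ι → ℝ) : Prop :=
  IsDualFeasible A w y ∧
  ∀ z : ι → ℝ, IsDualFeasible A w z → ∑ i, y i * (b i : ℝ) ≤ ∑ i, z i * (b i : ℝ)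

/-- The rational system `A x ≤ b` is totally dual integral: for every integral `w` for which the
(real) minimum in the dual program exists, it is attained by an integral vector.
(A linear program with finite optimal value attains it.) -/
def IsTDI {ι : Type} [Fintype ι] {n : ℕ} (A : Matrix ι (Fin n) ℚ) (b : ι → ℚ) : Prop :=
  ∀ w : Fin n → ℤ, (∃ y : ι → ℝ, IsDualOptimal A b w y) →
    ∃ z : ι → ℤ, IsDualOptimal A b w (fun i => (z i : ℝ))

/-- The rational system `A x ≤ b` is box-totally dual integral: the system
`A x ≤ b, x ≤ c, -x ≤ -d` is totally dual integral for all rational vectors `c` and `d`. -/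
def IsBoxTDI {m n : ℕ} (A : Matrix (Fin m) (Fin n) ℚ) (b : Fin m → ℚ) : Prop :=
  ∀ c d : Fin n → ℚ,
    IsTDI (Matrix.fromRows A (Matrix.fromRows (1 : Matrix (Fin n) (Fin n) ℚ) (-1)))
      (Sum.elim b (Sum.elim c (-d)))

/-- A box-TDI polyhedron: one that can be described by a box-TDI system. -/
def IsBoxTDIPolyhedron {n : ℕ} (P : Set (Fin n → ℝ)) : Prop :=
  ∃ (m : ℕ) (A : Matrix (Fin m) (Fin n) ℚ) (b : Fin m → ℚ),
    IsBoxTDI A b ∧ P = ratSolutionSet A b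

/-! Let P = P₁ + P₂ with both summands L♮-convex. A vector is normal to P at x₁ + x₂ exactly when it
is normal to P₁ at x₁ and to P₂ at x₂. Adding a coordinate makes each summand the section of an
L-convex polyhedron, whose cone of feasible directions is cut out by inequalities zᵢ ≤ zⱼ. By
Farkas, its normals are divergences of nonnegative flows on the tight arcs (i, j)
(`exists_flow_of_isMaxOn`). So a normal of P is a common divergence of two flows on n + 1 vertices.

Flow integrality then gives box-TDI. If w is integral and w - s is normal at x, both flows and s can
be rounded simultaneously (`exists_rounded_flow_pair`). Zeros stay zero, so the flows keep their
tight supports and r, the rounding of s, acquires no new signs. The integral common divergence w - r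
splits into common divergences of 0-1 flows (`divergence_mem_closure`), which are integral normals
with entries at most n + 1 in absolute value. There are finitely many such vectors, and their
inequalities form the box-TDI system. The parts of r go to the box multipliers, and complementary
slackness certifies optimality.

For integral sets, the hull of an L-convex set is described by its integer bounds on coordinate
differences, because x is the average of the roundings ⌊x + t𝟏⌋. Convex hulls commute with Minkowski
sums. -/

open Matrix

/-! ### Fourier–Motzkin elimination over a subfield -/

/-- Polyhedra in `ℝ^ι` described by finitely many inequalities with coefficients in `F`. -/
def IsPolyOver (F : Subfield ℝ) {ι : Type*} [Fintype ι] (P : Set (ι → ℝ)) : Prop :=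
  ∃ s : Set ((ι → ℝ) × ℝ), s.Finite ∧ (∀ c ∈ s, (∀ i, c.1 i ∈ F) ∧ c.2 ∈ F) ∧
    P = {x | ∀ c ∈ s, c.1 ⬝ᵥ x ≤ c.2}

namespace IsPolyOver

variable {F : Subfield ℝ} {ι κ : Type*} [Fintype ι] [Fintype κ]

theorem halfspace {a : ι → ℝ} {b : ℝ} (ha : ∀ i, a i ∈ F) (hb : b ∈ F) :
    IsPolyOver F {x | a ⬝ᵥ x ≤ b} :=
  ⟨{(a, b)}, Set.finite_singleton _, by simpa using ⟨ha, hb⟩, by simp⟩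

theorem inter {P Q : Set (ι → ℝ)} (hP : IsPolyOver F P) (hQ : IsPolyOver F Q) :
    IsPolyOver F (P ∩ Q) := by
  obtain ⟨s, hs, hsF, rfl⟩ := hP
  obtain ⟨t, ht, htF, rfl⟩ := hQ
  refine ⟨s ∪ t, hs.union ht, ?_, ?_⟩
  · rintro c (hc | hc)
    exacts [hsF c hc, htF c hc]
  · ext x
    simp only [Set.mem_inter_iff, Set.mem_ofPred_eq, Set.mem_union]
    exact ⟨fun h c hc => hc.elim (h.1 c) (h.2 c), fun h => ⟨fun c hc => h c (.inl hc),
      fun c hc => h c (.inr hc)⟩⟩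

theorem iInter {α : Type*} [Finite α] {P : α → Set (ι → ℝ)} (hP : ∀ k, IsPolyOver F (P k)) :
    IsPolyOver F (⋂ k, P k) := by
  choose s hs hsF hPs using hP
  refine ⟨⋃ k, s k, Set.finite_iUnion hs, ?_, ?_⟩
  · intro c hc
    obtain ⟨k, hk⟩ := Set.mem_iUnion.1 hc
    exact hsF k c hk
  · ext x
    simp only [hPs, Set.mem_iInter, Set.mem_ofPred_eq, Set.mem_iUnion]
    exact ⟨fun h c ⟨k, hk⟩ => h k c hk, fun h k c hk => h c ⟨k, hk⟩⟩

theorem preimage_mulVec {P : Set (κ → ℝ)} (hP : IsPolyOver F P) (M : Matrix κ ι ℝ)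
    (hM : ∀ k i, M k i ∈ F) : IsPolyOver F {x : ι → ℝ | M *ᵥ x ∈ P} := by
  obtain ⟨s, hs, hsF, rfl⟩ := hP
  refine ⟨(fun c => (c.1 ᵥ* M, c.2)) '' s, hs.image _, ?_, ?_⟩
  · rintro _ ⟨c, hc, rfl⟩
    exact ⟨fun i => F.sum_mem fun k _ => F.mul_mem ((hsF c hc).1 k) (hM k i), (hsF c hc).2⟩
  · ext x
    simp only [Set.mem_ofPred_eq, Set.forall_mem_image, dotProduct_mulVec]

theorem _root_.exists_between_of_finite {L U : Set ℝ} (hL : L.Finite) (hU : U.Finite)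
    (h : ∀ l ∈ L, ∀ u ∈ U, l ≤ u) : ∃ t, (∀ l ∈ L, l ≤ t) ∧ ∀ u ∈ U, t ≤ u := by
  rcases L.eq_empty_or_nonempty with rfl | hne
  · obtain ⟨t, ht⟩ := hU.bddBelow
    exact ⟨t, by simp, fun u hu => ht hu⟩
  · obtain ⟨t, ht, hmax⟩ := Set.exists_max_image L id hL hne
    exact ⟨t, hmax, h t ht⟩

/-- Fourier–Motzkin elimination of one coordinate. -/
theorem eliminate [DecidableEq ι] {P : Set (ι → ℝ)} (hP : IsPolyOver F P) (i : ι) :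
    IsPolyOver F {x | ∃ t : ℝ, x + Pi.single i t ∈ P} := by
  obtain ⟨s, hs, hsF, rfl⟩ := hP
  refine ⟨{c ∈ s | c.1 i = 0} ∪ (fun p : ((ι → ℝ) × ℝ) × ((ι → ℝ) × ℝ) =>
      (p.1.1 i • p.2 - p.2.1 i • p.1)) '' ({c ∈ s | 0 < c.1 i} ×ˢ {c ∈ s | c.1 i < 0}),
    (hs.subset (Set.sep_subset _ _)).union (((hs.subset (Set.sep_subset _ _)).prod
      (hs.subset (Set.sep_subset _ _))).image _), ?_, ?_⟩
  · rintro c (hc | ⟨⟨c, d⟩, ⟨hc, hd⟩, rfl⟩)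
    · exact hsF c hc.1
    · have h1 := hsF c hc.1
      have h2 := hsF d hd.1
      exact ⟨fun j => F.sub_mem (F.mul_mem (h1.1 i) (h2.1 j)) (F.mul_mem (h2.1 i) (h1.1 j)),
        F.sub_mem (F.mul_mem (h1.1 i) h2.2) (F.mul_mem (h2.1 i) h1.2)⟩
  · ext x
    simp only [Set.mem_ofPred_eq, dotProduct_add, dotProduct_single]
    constructor
    · rintro ⟨t, ht⟩ c (hc | ⟨⟨c, d⟩, ⟨hc, hd⟩, rfl⟩)
      · simpa [hc.2] using ht c hc.1
      · have h1 := mul_le_mul_of_nonneg_left (ht c hc.1) (neg_nonneg.2 hd.2.le)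
        have h2 := mul_le_mul_of_nonneg_left (ht d hd.1) hc.2.le
        simp only [Prod.fst_sub, Prod.smul_fst, Prod.snd_sub, Prod.smul_snd, sub_dotProduct,
          smul_dotProduct, smul_eq_mul]
        nlinarith
    · intro h
      obtain ⟨t, ht1, ht2⟩ := exists_between_of_finite
        (L := (fun c : (ι → ℝ) × ℝ => (c.2 - c.1 ⬝ᵥ x) / c.1 i) '' {c ∈ s | c.1 i < 0})
        (U := (fun c : (ι → ℝ) × ℝ => (c.2 - c.1 ⬝ᵥ x) / c.1 i) '' {c ∈ s | 0 < c.1 i})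
        ((hs.subset (Set.sep_subset _ _)).image _) ((hs.subset (Set.sep_subset _ _)).image _) (by
          rintro _ ⟨d, hd, rfl⟩ _ ⟨c, hc, rfl⟩
          have := h _ (.inr ⟨(c, d), ⟨hc, hd⟩, rfl⟩)
          simp only [Prod.fst_sub, Prod.smul_fst, Prod.snd_sub, Prod.smul_snd, sub_dotProduct,
            smul_dotProduct, smul_eq_mul] at this
          rw [le_div_iff₀ hc.2, div_mul_eq_mul_div, div_le_iff_of_neg hd.2]
          nlinarith)
      refine ⟨t, fun c hc => ?_⟩
      rcases lt_trichotomy (c.1 i) 0 with h0 | h0 | h0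
      · have := ht1 _ ⟨c, ⟨hc, h0⟩, rfl⟩
        rw [div_le_iff_of_neg h0] at this
        linarith
      · simpa [h0] using h c (.inl ⟨hc, h0⟩)
      · have := ht2 _ ⟨c, ⟨hc, h0⟩, rfl⟩
        rw [le_div_iff₀ h0] at this
        linarith

theorem eliminate_finset [DecidableEq ι] {P : Set (ι → ℝ)} (hP : IsPolyOver F P) (T : Finset ι) :
    IsPolyOver F {x | ∃ y : ι → ℝ, (∀ i ∉ T, y i = 0) ∧ x + y ∈ P} := by
  induction T using Finset.induction_on with
  | empty =>
    convert hP using 1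
    ext x
    constructor
    · rintro ⟨y, hy, h⟩
      have : y = 0 := by ext i; simpa using hy i
      simpa [this] using h
    · exact fun h => ⟨0, by simp, by simpa using h⟩
  | insert j T hj ih =>
    convert ih.eliminate j using 1
    ext x
    constructor
    · rintro ⟨y, hy, h⟩
      refine ⟨y j, y - Pi.single j (y j), fun i hi => ?_, by convert h using 1; abel⟩
      by_cases hij : i = j
      · subst hij; simp
      · simp [hij, hy i (by simp [hij, hi])]
    · rintro ⟨t, y, hy, h⟩
      refine ⟨Pi.single j t + y, fun i hi => ?_, by rwa [← add_assoc]⟩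
      simp only [Finset.mem_insert, not_or] at hi
      simp [hi.1, hy i hi.2]

theorem projection {P : Set (ι ⊕ κ → ℝ)} (hP : IsPolyOver F P) :
    IsPolyOver F {x : ι → ℝ | ∃ y : κ → ℝ, Sum.elim x y ∈ P} := by
  classical
  -- Eliminate every `κ`-coordinate, then pull back along x ↦ (x, 0).
  convert (hP.eliminate_finset (Finset.univ.map ⟨Sum.inr, Sum.inr_injective⟩)).preimage_mulVec
    (Matrix.fromRows (1 : Matrix ι ι ℝ) (0 : Matrix κ ι ℝ)) ?_ using 1
  · ext x
    simp only [Set.mem_ofPred_eq, fromRows_mulVec, one_mulVec, zero_mulVec]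
    constructor
    · rintro ⟨y, hy⟩
      refine ⟨Sum.elim 0 y, ?_, ?_⟩
      · rintro (i | i) <;> simp
      · rw [← Sum.elim_add_add]; simpa using hy
    · rintro ⟨y, hy, h⟩
      refine ⟨y ∘ Sum.inr, ?_⟩
      convert h using 1
      ext (i | i)
      · simp [hy (.inl i)]
      · simp
  · rintro (k | k) i
    · by_cases h : k = i
      · subst h; simp [F.one_mem]
      · simp [h, F.zero_mem]
    · simp [F.zero_mem]

/-- The image of a polyhedron under a linear map is a polyhedron. -/
theorem image_mulVec {P : Set (κ → ℝ)} (hP : IsPolyOver F P) (M : Matrix ι κ ℝ)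
    (hM : ∀ i k, M i k ∈ F) : IsPolyOver F ((M *ᵥ ·) '' P) := by
  classical
  -- The image is the projection of {(x, y) : y ∈ P, x = My}, with the equation split into two
  -- inequalities.
  have h1 : IsPolyOver F {v : ι ⊕ κ → ℝ | Matrix.fromCols (0 : Matrix κ ι ℝ) 1 *ᵥ v ∈ P} := by
    refine hP.preimage_mulVec _ ?_
    rintro k (i | i)
    · simp [F.zero_mem]
    · by_cases h : k = i
      · subst h; simp [F.one_mem]
      · simp [h, F.zero_mem]
  have h2 : IsPolyOver F {v : ι ⊕ κ → ℝ | ∀ i, (Matrix.fromCols (-1 : Matrix ι ι ℝ) M *ᵥ v) i ≤ 0} := by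
    have := iInter (F := F) (P := fun i =>
      {v : ι ⊕ κ → ℝ | Matrix.fromCols (-1 : Matrix ι ι ℝ) M i ⬝ᵥ v ≤ 0}) fun i => by
        refine halfspace ?_ F.zero_mem
        rintro (j | j)
        · by_cases h : i = j
          · subst h; simp [F.one_mem]
          · simp [h, F.zero_mem]
        · exact hM i j
    convert this using 1
    ext v
    simp [mulVec]
  have h3 : IsPolyOver F {v : ι ⊕ κ → ℝ | ∀ i, (Matrix.fromCols (1 : Matrix ι ι ℝ) (-M) *ᵥ v) i ≤ 0} := by
    have := iInter (F := F) (P := fun i =>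
      {v : ι ⊕ κ → ℝ | Matrix.fromCols (1 : Matrix ι ι ℝ) (-M) i ⬝ᵥ v ≤ 0}) fun i => by
        refine halfspace ?_ F.zero_mem
        rintro (j | j)
        · by_cases h : i = j
          · subst h; simp [F.one_mem]
          · simp [h, F.zero_mem]
        · exact F.neg_mem (hM i j)
    convert this using 1
    ext v
    simp [mulVec]
  convert (h1.inter (h2.inter h3)).projection using 1
  ext x
  simp only [Set.mem_image, Set.mem_ofPred_eq, Set.mem_inter_iff, fromCols_mulVec_sumElim, zero_mulVec, one_mulVec,
    zero_add, neg_mulVec, Pi.add_apply, Pi.neg_apply]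
  constructor
  · rintro ⟨y, hy, rfl⟩
    exact ⟨y, hy, by simp, by simp⟩
  · rintro ⟨y, hy, h, h'⟩
    refine ⟨y, hy, funext fun i => ?_⟩
    linarith [h i, h' i]

theorem add {P Q : Set (ι → ℝ)} (hP : IsPolyOver F P) (hQ : IsPolyOver F Q) :
    IsPolyOver F (P + Q) := by
  classical
  have hone : ∀ i j, (1 : Matrix ι ι ℝ) i j ∈ F := fun i j => by
    by_cases h : i = j
    · subst h; simp [F.one_mem]
    · simp [h, F.zero_mem]
  have h1 : IsPolyOver F {v : ι ⊕ ι → ℝ | Matrix.fromCols (1 : Matrix ι ι ℝ) 0 *ᵥ v ∈ P} := by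
    refine hP.preimage_mulVec _ ?_
    rintro k (i | i)
    exacts [hone _ _, F.zero_mem]
  have h2 : IsPolyOver F {v : ι ⊕ ι → ℝ | Matrix.fromCols (0 : Matrix ι ι ℝ) 1 *ᵥ v ∈ Q} := by
    refine hQ.preimage_mulVec _ ?_
    rintro k (i | i)
    exacts [F.zero_mem, hone _ _]
  convert (h1.inter h2).image_mulVec (Matrix.fromCols (1 : Matrix ι ι ℝ) 1) ?_ using 1
  · ext x
    constructor
    · rintro ⟨y, hy, z, hz, rfl⟩
      exact ⟨Sum.elim y z, by simpa using ⟨hy, hz⟩, by simp⟩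
    · rintro ⟨v, ⟨hy, hz⟩, rfl⟩
      obtain ⟨y, z, rfl⟩ : ∃ y z, v = Sum.elim y z :=
        ⟨v ∘ Sum.inl, v ∘ Sum.inr, (Sum.elim_comp_inl_inr v).symm⟩
      exact ⟨y, by simpa using hy, z, by simpa using hz, by simp⟩
  · rintro k (i | i)
    exacts [hone _ _, hone _ _]

/-- A linear functional bounded above on a nonempty polyhedron attains its maximum, and the
maximum lies in the field of coefficients. -/
theorem exists_isGreatest {P : Set (ι → ℝ)} (hP : IsPolyOver F P) (hne : P.Nonempty) {g : ι → ℝ}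
    (hg : ∀ i, g i ∈ F) (hbdd : BddAbove ((g ⬝ᵥ ·) '' P)) :
    ∃ b ∈ F, IsGreatest ((g ⬝ᵥ ·) '' P) b := by
  obtain ⟨s, hs, hsF, hEq⟩ := hP.image_mulVec (Matrix.of fun _ : Unit => g) fun _ => hg
  have key : ∀ t : ℝ, t ∈ (g ⬝ᵥ ·) '' P ↔ ∀ c ∈ s, c.1 () * t ≤ c.2 := by
    intro t
    have : (fun _ : Unit => t) ∈ ((Matrix.of fun _ : Unit => g) *ᵥ ·) '' P ↔
        ∀ c ∈ s, c.1 () * t ≤ c.2 := by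
      rw [hEq]; simp [dotProduct]
    rw [← this]
    refine exists_congr fun x => and_congr_right fun _ => ?_
    simp [funext_iff, mulVec]
  obtain ⟨t₀, ht₀⟩ := hne.image (g ⬝ᵥ ·)
  have hfin : {c ∈ s | 0 < c.1 ()}.Finite := hs.subset (Set.sep_subset _ _)
  have hpos : {c ∈ s | 0 < c.1 ()}.Nonempty := by
    by_contra hemp
    obtain ⟨M, hM⟩ := hbdd
    have h0 := hM ht₀
    have : M + 1 ∈ (g ⬝ᵥ ·) '' P := by
      refine (key _).2 fun c hc => ?_
      have h1 := (key _).1 ht₀ c hc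
      have h2 : c.1 () ≤ 0 := not_lt.1 fun h => hemp ⟨c, hc, h⟩
      nlinarith
    linarith [hM this]
  -- The image is a subset of the line cut out by finitely many inequalities over `F`; its maximum
  -- is the least upper bound imposed by those with positive coefficient.
  obtain ⟨c, ⟨hc, hc0⟩, hmin⟩ := Set.exists_min_image _ (fun c : (Unit → ℝ) × ℝ => c.2 / c.1 ()) hfin hpos
  refine ⟨c.2 / c.1 (), F.div_mem (hsF c hc).2 ((hsF c hc).1 ()), (key _).2 fun d hd => ?_, ?_⟩
  · rcases lt_or_ge 0 (d.1 ()) with h | h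
    · have := hmin d ⟨hd, h⟩
      rw [le_div_iff₀ h] at this
      linarith
    · have h1 := (key _).1 ht₀ d hd
      have h2 := (key _).1 ht₀ c hc
      have : t₀ ≤ c.2 / c.1 () := by rw [le_div_iff₀ hc0]; linarith
      nlinarith
  · intro t ht
    rw [le_div_iff₀ hc0]
    linarith [(key _).1 ht c hc]

end IsPolyOver

/-! ### Farkas' lemma and linear programming duality -/

section Farkas

variable {ι κ : Type*} [Fintype ι] [Fintype κ]

/-- **Farkas' lemma.** -/
theorem exists_nonneg_vecMul_eq (A : Matrix κ ι ℝ) (w : ι → ℝ)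
    (h : ∀ z, (∀ k, (A *ᵥ z) k ≤ 0) → w ⬝ᵥ z ≤ 0) : ∃ y : κ → ℝ, (∀ k, 0 ≤ y k) ∧ y ᵥ* A = w := by
  classical
  have h1 : IsPolyOver ⊤ {y : κ → ℝ | ∀ k, 0 ≤ y k} := by
    have := IsPolyOver.iInter (F := ⊤) (P := fun k => {y : κ → ℝ | Pi.single k (-1) ⬝ᵥ y ≤ 0})
      fun k => IsPolyOver.halfspace (fun _ => Subfield.mem_top _) (Subfield.mem_top _)
    convert this using 1
    ext y
    simp
  -- The cone generated by the rows of `A` is an image of the orthant, hence a finite intersection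
  -- of half-spaces c · v ≤ γ. Taking v = 0 gives γ ≥ 0, and scaling the generators forces Ac ≤ 0;
  -- the hypothesis then yields c · w ≤ 0 ≤ γ.
  obtain ⟨s, -, -, hs⟩ := h1.image_mulVec Aᵀ fun _ _ => Subfield.mem_top _
  have key : ∀ v, (∃ y : κ → ℝ, (∀ k, 0 ≤ y k) ∧ y ᵥ* A = v) ↔ ∀ c ∈ s, c.1 ⬝ᵥ v ≤ c.2 := by
    intro v
    have := Set.ext_iff.1 hs v
    simpa [mulVec_transpose] using this
  rw [key]
  intro c hc
  have h0 : 0 ≤ c.2 := by simpa using (key 0).1 ⟨0, by simp, by simp⟩ c hc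
  refine le_trans ?_ h0
  rw [dotProduct_comm]
  refine h _ fun k => ?_
  by_contra! hk
  have := (key _).1 ⟨Pi.single k ((c.2 + 1) / (A *ᵥ c.1) k), fun j => by
    by_cases hj : j = k
    · subst hj; simpa using div_nonneg (by linarith) hk.le
    · simp [hj], rfl⟩ c hc
  rw [dotProduct_comm, ← dotProduct_mulVec, single_dotProduct, div_mul_cancel₀ _ hk.ne'] at this
  linarith

/-- Homogenization: a solution (x, t) of Ax + tb ≤ 0 with t < 0 would rescale to a solution of the
system, so the cone form of Farkas applies with target (0, -1). The slack multiplier is nonnegative,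
hence y · b ≤ -1. -/
theorem exists_farkas_certificate (A : Matrix κ ι ℝ) (b : κ → ℝ)
    (h : ¬ ∃ x, ∀ k, (A *ᵥ x) k ≤ b k) :
    ∃ y : κ → ℝ, (∀ k, 0 ≤ y k) ∧ y ᵥ* A = 0 ∧ y ⬝ᵥ b < 0 := by
  obtain ⟨y, hy, hyw⟩ := exists_nonneg_vecMul_eq
    (Matrix.fromBlocks A (Matrix.of fun k (_ : Unit) => b k) (0 : Matrix Unit ι ℝ) 1)
    (Sum.elim 0 fun _ => -1) (by
      intro z hz
      obtain ⟨x, t, rfl⟩ : ∃ x t, z = Sum.elim x fun _ => t :=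
        ⟨z ∘ Sum.inl, z (Sum.inr ()), by ext (i | i) <;> rfl⟩
      simp only [fromBlocks_mulVec, Sum.forall, Sum.elim_inl, Sum.elim_inr] at hz
      have h1 : ∀ k, (A *ᵥ x) k + b k * t ≤ 0 := fun k => by
        simpa [mulVec, dotProduct] using hz.1 k
      by_contra! hlt
      have ht : t < 0 := by simpa [dotProduct] using hlt
      refine h ⟨(-t)⁻¹ • x, fun k => ?_⟩
      rw [mulVec_smul, Pi.smul_apply, smul_eq_mul, inv_mul_le_iff₀ (by linarith)]
      linarith [h1 k])
  refine ⟨y ∘ Sum.inl, fun k => hy _, ?_, ?_⟩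
  · ext i
    have := congrFun hyw (Sum.inl i)
    simpa [vecMul, dotProduct] using this
  · have := congrFun hyw (Sum.inr ())
    have h1 := hy (Sum.inr ())
    simp [vecMul, dotProduct] at this
    simp [dotProduct]
    linarith

/-- Strong duality, from a dual optimal solution. -/
theorem exists_primal_of_dual_optimal (A : Matrix κ ι ℝ) (b : κ → ℝ) (y : κ → ℝ)
    (hy : ∀ k, 0 ≤ y k)
    (hopt : ∀ z : κ → ℝ, (∀ k, 0 ≤ z k) → z ᵥ* A = y ᵥ* A → y ⬝ᵥ b ≤ z ⬝ᵥ b) :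
    ∃ x, (∀ k, (A *ᵥ x) k ≤ b k) ∧ ∀ k, 0 < y k → (A *ᵥ x) k = b k := by
  have main : ∃ x, (∀ k, (A *ᵥ x) k ≤ b k) ∧ y ⬝ᵥ b ≤ y ⬝ᵥ (A *ᵥ x) := by
    by_contra hno
    -- A certificate (l, t) satisfies lA = t·yA and l · b < t(y · b). Then y + l if t = 0, or l / t
    -- if t > 0, is dual feasible and cheaper than y.
    obtain ⟨v, hv, hv0, hvb⟩ := exists_farkas_certificate
      (Matrix.fromRows A (Matrix.of fun _ : Unit => - (y ᵥ* A))) (Sum.elim b fun _ => - (y ⬝ᵥ b)) (by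
        rintro ⟨x, hx⟩
        refine hno ⟨x, fun k => by simpa using hx (Sum.inl k), ?_⟩
        have := hx (Sum.inr ())
        rw [dotProduct_mulVec]
        have h' : (-(y ᵥ* A)) ⬝ᵥ x ≤ -(y ⬝ᵥ b) := this
        rw [neg_dotProduct] at h'
        linarith)
    obtain ⟨l, t, rfl⟩ : ∃ l t, v = Sum.elim l fun _ : Unit => t :=
      ⟨v ∘ Sum.inl, v (Sum.inr ()), by ext (i | i) <;> rfl⟩
    have hl : ∀ k, 0 ≤ l k := fun k => hv (Sum.inl k)
    have ht : 0 ≤ t := hv (Sum.inr ())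
    have hA : l ᵥ* A = t • (y ᵥ* A) := by
      ext i
      have := congrFun hv0 i
      rw [vecMul_fromRows] at this
      have h' : (l ᵥ* A) i + t * -(y ᵥ* A) i = 0 := by
        simpa [vecMul, dotProduct] using this
      simp only [Pi.smul_apply, smul_eq_mul]
      linarith
    have hb : l ⬝ᵥ b < t * (y ⬝ᵥ b) := by
      have : l ⬝ᵥ b + t * -(y ⬝ᵥ b) < 0 := by simpa [dotProduct] using hvb
      linarith
    rcases ht.eq_or_lt with rfl | ht
    · have := hopt (y + l) (fun k => add_nonneg (hy k) (hl k)) (by simp [add_vecMul, hA])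
      rw [add_dotProduct] at this
      linarith
    · have := hopt (t⁻¹ • l) (fun k => mul_nonneg (inv_nonneg.2 ht.le) (hl k))
        (by rw [smul_vecMul, hA, smul_smul, inv_mul_cancel₀ ht.ne', one_smul])
      rw [smul_dotProduct, smul_eq_mul, le_inv_mul_iff₀ ht] at this
      linarith
  obtain ⟨x, hx, hle⟩ := main
  refine ⟨x, hx, fun k hk => ?_⟩
  have h0 : ∀ k ∈ Finset.univ, y k * (A *ᵥ x) k ≤ y k * b k := fun k _ =>
    mul_le_mul_of_nonneg_left (hx k) (hy k)
  have := (Finset.sum_eq_sum_iff_of_le h0).1 (le_antisymm (Finset.sum_le_sum h0) hle) k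
    (Finset.mem_univ k)
  exact mul_left_cancel₀ hk.ne' this

end Farkas

/-! ### Integral rounding and decomposition of flows -/

section Flow

variable {V : Type*} [Fintype V]

/-- The net outflow of `f` at `v`. -/
def divergence {R : Type*} [AddCommGroup R] (f : V → V → R) (v : V) : R :=
  ∑ u, f v u - ∑ u, f u v

theorem sum_divergence {R : Type*} [AddCommGroup R] (f : V → V → R) :
    ∑ v, divergence f v = 0 := by
  simp only [divergence, Finset.sum_sub_distrib]
  rw [Finset.sum_comm, sub_self]

theorem divergence_sub {R : Type*} [AddCommGroup R] (f g : V → V → R) :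
    divergence (f - g) = divergence f - divergence g := by
  ext v
  simp only [divergence, Pi.sub_apply, Finset.sum_sub_distrib]
  abel

theorem divergence_add_smul (f g : V → V → ℝ) (t : ℝ) (v : V) :
    divergence (f + t • g) v = divergence f v + t * divergence g v := by
  simp only [divergence, Pi.add_apply, Pi.smul_apply, smul_eq_mul, Finset.sum_add_distrib,
    ← Finset.mul_sum]
  ring

theorem intCast_divergence (f : V → V → ℤ) (v : V) :
    ((divergence f v : ℤ) : ℝ) = divergence (fun u v => (f u v : ℝ)) v := by
  simp [divergence]

/-- Inflow and outflow both lie between 0 and the number of vertices. With n + 1 vertices this is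
the bound in `smallNormals`. -/
theorem abs_divergence_le {f : V → V → ℤ} (h0 : ∀ u v, 0 ≤ f u v) (h1 : ∀ u v, f u v ≤ 1) (v : V) :
    |divergence f v| ≤ Fintype.card V := by
  have hb : ∀ g : V → ℤ, (∀ u, 0 ≤ g u) → (∀ u, g u ≤ 1) →
      0 ≤ ∑ u, g u ∧ ∑ u, g u ≤ Fintype.card V := fun g hg0 hg1 =>
    ⟨Finset.sum_nonneg fun u _ => hg0 u,
      (Finset.sum_le_sum fun u _ => hg1 u).trans (by simp)⟩
  have h2 := hb (f v) (h0 v) (h1 v)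
  have h3 := hb (fun u => f u v) (fun u => h0 u v) (fun u => h1 u v)
  rw [divergence, abs_le]
  constructor <;> linarith

theorem sum_mul_divergence (f : V → V → ℝ) (x : V → ℝ) :
    ∑ v, divergence f v * x v = ∑ u, ∑ v, f u v * (x u - x v) := by
  simp only [divergence, sub_mul, Finset.sum_sub_distrib, Finset.sum_mul, mul_sub]
  congr 1
  rw [Finset.sum_comm]

/-- A vertex with integral divergence is not incident with exactly one fractional arc. -/
theorem two_le_fractional_degree {f : V → V → ℝ} {v : V} {d : ℤ} (hd : divergence f v = d)
    (E : Finset (V × V)) (hE : ∀ p, p ∈ E ↔ f p.1 p.2 ∉ (Int.castAddHom ℝ).range)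
    [DecidableEq V]
    (hv : ∃ u, (v, u) ∈ E ∨ (u, v) ∈ E) :
    2 ≤ (E.filter fun p => p.1 = v).card + (E.filter fun p => p.2 = v).card := by
  set Z := (Int.castAddHom ℝ).range
  by_contra! hlt
  obtain ⟨u, hu | hu⟩ := hv
  · have h1 : (v, u) ∈ E.filter fun p => p.1 = v := by simp [hu]
    have hc1 := Finset.card_pos.2 ⟨_, h1⟩
    have hin : ∀ x, f x v ∈ Z := by
      intro x
      by_contra hx
      have : (x, v) ∈ E.filter fun p => p.2 = v := by simp [hE, hx]
      have := Finset.card_pos.2 ⟨_, this⟩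
      omega
    have hout : ∀ x ≠ u, f v x ∈ Z := by
      intro x hxu
      by_contra hx
      have h2 : (v, x) ∈ E.filter fun p => p.1 = v := by simp [hE, hx]
      have := Finset.card_le_one.1 (by omega) _ h1 _ h2
      exact hxu (Prod.mk.inj this).2.symm
    refine (hE _).1 hu ?_
    -- The divergence equation writes the only fractional value as a sum of integers.
    have : f v u = d + ∑ x, f x v - ∑ x ∈ Finset.univ.erase u, f v x := by
      rw [← hd, divergence, ← Finset.add_sum_erase _ _ (Finset.mem_univ u)]
      ring
    rw [this]
    exact sub_mem (add_mem ⟨d, rfl⟩ (sum_mem fun x _ => hin x))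
      (sum_mem fun x hx => hout x (Finset.ne_of_mem_erase hx))
  · have h1 : (u, v) ∈ E.filter fun p => p.2 = v := by simp [hu]
    have hc1 := Finset.card_pos.2 ⟨_, h1⟩
    have hout : ∀ x, f v x ∈ Z := by
      intro x
      by_contra hx
      have : (v, x) ∈ E.filter fun p => p.1 = v := by simp [hE, hx]
      have := Finset.card_pos.2 ⟨_, this⟩
      omega
    have hin : ∀ x ≠ u, f x v ∈ Z := by
      intro x hxu
      by_contra hx
      have h2 : (x, v) ∈ E.filter fun p => p.2 = v := by simp [hE, hx]
      have := Finset.card_le_one.1 (by omega) _ h1 _ h2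
      exact hxu (Prod.mk.inj this).1.symm
    refine (hE _).1 hu ?_
    have : f u v = ∑ x, f v x - ∑ x ∈ Finset.univ.erase u, f x v - d := by
      rw [← hd, divergence, ← Finset.add_sum_erase _ (fun x => f x v) (Finset.mem_univ u)]
      ring
    rw [this]
    exact sub_mem (sub_mem (sum_mem fun x _ => hout x)
      (sum_mem fun x hx => hin x (Finset.ne_of_mem_erase hx))) ⟨d, rfl⟩

/-- A flow with integral divergence that is not integral admits a nonzero circulation supported on
its fractional arcs. -/
theorem exists_fractional_circulation (f : V → V → ℝ) (d : V → ℤ)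
    (hd : ∀ v, divergence f v = d v) (hf : ∃ u v, f u v ∉ (Int.castAddHom ℝ).range) :
    ∃ z : V → V → ℝ, z ≠ 0 ∧ (∀ v, divergence z v = 0) ∧
      ∀ u v, f u v ∈ (Int.castAddHom ℝ).range → z u v = 0 := by
  classical
  set E : Finset (V × V) := Finset.univ.filter fun p => f p.1 p.2 ∉ (Int.castAddHom ℝ).range with hEdef
  have hE : ∀ p, p ∈ E ↔ f p.1 p.2 ∉ (Int.castAddHom ℝ).range := fun p => by simp [hEdef]
  set T : Finset V := Finset.univ.filter fun v => ∃ u, (v, u) ∈ E ∨ (u, v) ∈ E with hTdef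
  have hT : ∀ v, v ∈ T ↔ ∃ u, (v, u) ∈ E ∨ (u, v) ∈ E := fun v => by simp [hTdef]
  -- Degree count: each vertex of `T` has fractional degree at least 2, and the degrees sum to 2|E|.
  have hcard : T.card ≤ E.card := by
    have h1 : E.card = ∑ v ∈ T, (E.filter fun p => p.1 = v).card :=
      Finset.card_eq_sum_card_fiberwise fun p hp => (hT _).2 ⟨p.2, .inl hp⟩
    have h2 : E.card = ∑ v ∈ T, (E.filter fun p => p.2 = v).card :=
      Finset.card_eq_sum_card_fiberwise fun p hp => (hT _).2 ⟨p.1, .inr hp⟩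
    have h3 : ∑ v ∈ T, 2 ≤ ∑ v ∈ T, ((E.filter fun p => p.1 = v).card +
        (E.filter fun p => p.2 = v).card) :=
      Finset.sum_le_sum fun v hv => two_le_fractional_degree (hd v) E hE ((hT v).1 hv)
    rw [Finset.sum_add_distrib, ← h1, ← h2] at h3
    simp at h3
    omega
  obtain ⟨a, b, hab⟩ := hf
  have habE : (a, b) ∈ E := (hE _).2 hab
  have haT : a ∈ T := (hT _).2 ⟨b, .inl habE⟩
  let ext : (E → ℝ) →ₗ[ℝ] (V → V → ℝ) :=
    { toFun := fun z u v => if h : (u, v) ∈ E then z ⟨_, h⟩ else 0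
      map_add' := fun x y => by ext u v; by_cases h : (u, v) ∈ E <;> simp [h]
      map_smul' := fun c x => by ext u v; by_cases h : (u, v) ∈ E <;> simp [h] }
  -- The equation at `a` may be dropped because divergences sum to zero. This leaves |T| - 1
  -- equations in |E| ≥ |T| unknowns.
  let φ : (E → ℝ) →ₗ[ℝ] (T.erase a → ℝ) :=
    { toFun := fun z v => divergence (ext z) v
      map_add' := fun x y => by
        ext v
        simp only [divergence, map_add, Pi.add_apply, Finset.sum_add_distrib]
        ring
      map_smul' := fun c x => by
        ext v
        simp only [divergence, map_smul, Pi.smul_apply, smul_eq_mul, ← Finset.mul_sum,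
          RingHom.id_apply]
        ring }
  have hker : LinearMap.ker φ ≠ ⊥ := by
    apply LinearMap.ker_ne_bot_of_finrank_lt
    have := Finset.card_pos.2 ⟨a, haT⟩
    simp only [Module.finrank_fintype_fun_eq_card, Fintype.card_coe, Finset.card_erase_of_mem haT]
    omega
  obtain ⟨z, hz, hz0⟩ := (Submodule.ne_bot_iff _).1 hker
  have hext : ∀ u v, (u, v) ∉ E → ext z u v = 0 := fun u v h => dif_neg h
  have hne : ∀ v, v ≠ a → divergence (ext z) v = 0 := by
    intro v hva
    by_cases hv : v ∈ T
    · exact congrFun (LinearMap.mem_ker.1 hz) ⟨v, Finset.mem_erase.2 ⟨hva, hv⟩⟩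
    · have h : ∀ u, (v, u) ∉ E ∧ (u, v) ∉ E := fun u =>
        ⟨fun h => hv ((hT v).2 ⟨u, .inl h⟩), fun h => hv ((hT v).2 ⟨u, .inr h⟩)⟩
      simp [divergence, hext _ _ (h _).1, hext _ _ (h _).2]
  refine ⟨ext z, fun h => hz0 ?_, fun v => ?_, fun u v h => hext u v fun h' => (hE _).1 h' h⟩
  · ext ⟨⟨u, v⟩, hp⟩
    have : ext z u v = z ⟨(u, v), hp⟩ := dif_pos hp
    rw [← this, h]
    rfl
  · by_cases hva : v = a
    · subst hva
      rw [← sum_divergence (ext z)]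
      exact (Finset.sum_eq_single v (fun u _ hu => hne u hu) (by simp)).symm
    · exact hne v hva

/-- A flow with integral divergence can be rounded to an integral one. -/
theorem exists_rounded_flow (f : V → V → ℝ) (d : V → ℤ) (hd : ∀ v, divergence f v = d v) :
    ∃ g : V → V → ℤ, (∀ u v, ⌊f u v⌋ ≤ g u v ∧ g u v ≤ ⌈f u v⌉) ∧ ∀ v, divergence g v = d v := by
  let lo : V → V → ℝ := fun u v => ⌊f u v⌋
  let hi : V → V → ℝ := fun u v => ⌈f u v⌉
  -- An extreme point of this compact set is integral: otherwise a circulation on its fractional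
  -- arcs, which lie strictly between their integral bounds, moves it both ways inside `K`.
  let K : Set (V → V → ℝ) := Set.Icc lo hi ∩ {g | ∀ v, divergence g v = d v}
  have hK : IsCompact K := by
    refine isCompact_Icc.inter_right ?_
    have : {g : V → V → ℝ | ∀ v, divergence g v = d v} = ⋂ v, {g : V → V → ℝ | divergence g v = d v} := by
      ext; simp
    rw [this]
    refine isClosed_iInter fun v => isClosed_eq ?_ continuous_const
    unfold divergence
    fun_prop
  obtain ⟨g, hg⟩ := hK.extremePoints_nonempty
    ⟨f, ⟨fun u v => Int.floor_le _, fun u v => Int.le_ceil _⟩, hd⟩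
  rw [mem_extremePoints_iff_left] at hg
  obtain ⟨⟨⟨hlo, hhi⟩, hgd⟩, hext⟩ := hg
  have hint : ∀ u v, g u v ∈ (Int.castAddHom ℝ).range := by
    by_contra! hfrac
    obtain ⟨z, hz0, hzd, hzs⟩ := exists_fractional_circulation g d hgd hfrac
    have hev : ∀ᶠ t in nhds (0 : ℝ), ∀ u v, lo u v ≤ g u v + t * z u v ∧ g u v + t * z u v ≤ hi u v := by
      refine Filter.eventually_all.2 fun u => Filter.eventually_all.2 fun v => ?_
      by_cases huv : g u v ∈ (Int.castAddHom ℝ).range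
      · simpa [hzs u v huv] using ⟨hlo u v, hhi u v⟩
      · have hcont : Filter.Tendsto (fun t : ℝ => g u v + t * z u v) (nhds 0) (nhds (g u v)) := by
          have : Continuous fun t : ℝ => g u v + t * z u v := by fun_prop
          simpa using this.tendsto 0
        have h1 : lo u v < g u v := (hlo u v).lt_of_ne fun h => huv ⟨_, h⟩
        have h2 : g u v < hi u v := (hhi u v).lt_of_ne fun h => huv ⟨_, h.symm⟩
        filter_upwards [hcont.eventually (Ioo_mem_nhds h1 h2)] with t ht
        exact ⟨ht.1.le, ht.2.le⟩
    obtain ⟨t, ⟨ht1, ht2⟩, ht0⟩ := ((((hev.and ((continuous_neg.tendsto' (0 : ℝ) 0 neg_zero).eventually hev)).filter_mono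
      nhdsWithin_le_nhds).and self_mem_nhdsWithin : ∀ᶠ t in nhdsWithin (0 : ℝ) (Set.Ioi 0), _)).exists
    have hmem : ∀ t : ℝ, (∀ u v, lo u v ≤ g u v + t * z u v ∧ g u v + t * z u v ≤ hi u v) →
        g + t • z ∈ K := fun t ht =>
      ⟨⟨fun u v => (ht u v).1, fun u v => (ht u v).2⟩, fun v => by
        rw [divergence_add_smul, hgd, hzd, mul_zero, add_zero]⟩
    have := hext _ (hmem t ht1) _ (hmem (-t) ht2)
      ⟨1 / 2, 1 / 2, by norm_num, by norm_num, by norm_num, by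
        rw [neg_smul, smul_add, smul_add, smul_neg, add_add_add_comm, add_neg_cancel, add_zero,
          ← add_smul]
        norm_num⟩
    have h2 : t • z = 0 := by simpa using this
    rcases smul_eq_zero.1 h2 with h | h
    · exact ht0.ne' h
    · exact hz0 h
  choose k hk using hint
  have hk' : ∀ u v, (k u v : ℝ) = g u v := hk
  refine ⟨k, fun u v => ⟨?_, ?_⟩, fun v => ?_⟩
  · have : (⌊f u v⌋ : ℝ) ≤ k u v := hk' u v ▸ hlo u v
    exact_mod_cast this
  · have : (k u v : ℝ) ≤ ⌈f u v⌉ := hk' u v ▸ hhi u v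
    exact_mod_cast this
  · have h := intCast_divergence k v
    simp only [hk'] at h
    exact_mod_cast h.trans (hgd v)

/-- Simultaneous rounding of two flows and a common supply vector. -/
theorem exists_rounded_flow_pair (f₁ f₂ : V → V → ℝ) (s : V → ℝ) (w : V → ℤ)
    (h₁ : ∀ v, divergence f₁ v + s v = w v) (h₂ : ∀ v, divergence f₂ v + s v = w v) :
    ∃ (g₁ g₂ : V → V → ℤ) (r : V → ℤ), (∀ u v, ⌊f₁ u v⌋ ≤ g₁ u v ∧ g₁ u v ≤ ⌈f₁ u v⌉) ∧
      (∀ u v, ⌊f₂ u v⌋ ≤ g₂ u v ∧ g₂ u v ≤ ⌈f₂ u v⌉) ∧ (∀ v, ⌊s v⌋ ≤ r v ∧ r v ≤ ⌈s v⌉) ∧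
      (∀ v, divergence g₁ v + r v = w v) ∧ ∀ v, divergence g₂ v + r v = w v := by
  classical
  -- One flow on two copies of `V`: `f₁` on the first, `f₂` reversed on the second, and `s v` on the
  -- arc joining the copies of `v`. Both conditions become integral divergences, w and -w.
  let F : V ⊕ V → V ⊕ V → ℝ := fun a b => Sum.elim
    (fun u => Sum.elim (fun v => f₁ u v) (fun v => if u = v then s u else 0) b)
    (fun u => Sum.elim (fun _ => 0) (fun v => f₂ v u) b) a
  obtain ⟨G, hG, hGd⟩ := exists_rounded_flow F (Sum.elim w fun v => - w v) (by
    rintro (v | v)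
    · have := h₁ v
      simp only [divergence] at this
      simp [divergence, F, ← this]
      ring
    · have := h₂ v
      simp only [divergence] at this
      simp [divergence, F, ← this]
      ring)
  have h0 : ∀ u v, G (Sum.inr u) (Sum.inl v) = 0 := fun u v => by
    have := hG (Sum.inr u) (Sum.inl v)
    simp [F] at this
    omega
  have hd : ∀ u v, u ≠ v → G (Sum.inl u) (Sum.inr v) = 0 := fun u v huv => by
    have := hG (Sum.inl u) (Sum.inr v)
    simp [F, huv] at this
    omega
  refine ⟨fun u v => G (Sum.inl u) (Sum.inl v), fun u v => G (Sum.inr v) (Sum.inr u),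
    fun v => G (Sum.inl v) (Sum.inr v), fun u v => hG (Sum.inl u) (Sum.inl v),
    fun u v => hG (Sum.inr v) (Sum.inr u), fun v => ?_, fun v => ?_, fun v => ?_⟩
  · simpa [F] using hG (Sum.inl v) (Sum.inr v)
  · have h := hGd (Sum.inl v)
    have h1 : ∑ u, G (Sum.inl v) (Sum.inr u) = G (Sum.inl v) (Sum.inr v) :=
      Finset.sum_eq_single v (fun u _ hu => hd v u hu.symm) (by simp)
    simp only [divergence, Fintype.sum_sum_type, h0, h1, Sum.elim_inl] at h
    simp only [divergence]
    simp at h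
    linarith
  · have h := hGd (Sum.inr v)
    have h1 : ∑ u, G (Sum.inl u) (Sum.inr v) = G (Sum.inl v) (Sum.inr v) :=
      Finset.sum_eq_single v (fun u _ hu => hd u v hu) (by simp)
    simp only [divergence, Fintype.sum_sum_type, h0, h1, Sum.elim_inr] at h
    simp only [divergence]
    simp at h
    linarith

/-- The common divergence of two nonnegative integral flows is a sum of common divergences of
`0`-`1` flows. -/
theorem divergence_mem_closure (k : ℕ) : ∀ f₁ f₂ : V → V → ℤ,
    (∀ u v, 0 ≤ f₁ u v ∧ f₁ u v ≤ k) → (∀ u v, 0 ≤ f₂ u v ∧ f₂ u v ≤ k) →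
    divergence f₁ = divergence f₂ →
    divergence f₁ ∈ AddSubmonoid.closure {g : V → ℤ | ∃ z₁ z₂ : V → V → ℤ,
      (∀ u v, 0 ≤ z₁ u v ∧ z₁ u v ≤ 1 ∧ (f₁ u v = 0 → z₁ u v = 0)) ∧
      (∀ u v, 0 ≤ z₂ u v ∧ z₂ u v ≤ 1 ∧ (f₂ u v = 0 → z₂ u v = 0)) ∧
      divergence z₁ = g ∧ divergence z₂ = g} := by
  induction k with
  | zero =>
    intro f₁ f₂ h₁ _ _
    have : f₁ = 0 := by
      ext u v
      have := h₁ u v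
      simp at this ⊢
      omega
    have h0 : divergence f₁ = 0 := by ext v; simp [divergence, this]
    rw [h0]
    exact zero_mem _
  | succ k ih =>
    intro f₁ f₂ h₁ h₂ hdiv
    have hk : (0 : ℝ) < k + 1 := by positivity
    have hsc : ∀ f : V → V → ℤ, ∀ v, divergence (fun u v => (f u v : ℝ) / (k + 1)) v =
        ((divergence f v : ℤ) : ℝ) / (k + 1) := fun f v => by
      rw [intCast_divergence]
      simp only [divergence, ← Finset.sum_div, sub_div]
    -- Scaling by 1 / (k + 1) puts all entries in [0, 1], so the rounded flows are 0-1. The shared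
    -- supply r keeps their divergences equal.
    obtain ⟨z₁, z₂, r, hz₁, hz₂, -, hd₁, hd₂⟩ := exists_rounded_flow_pair
      (fun u v => (f₁ u v : ℝ) / (k + 1)) (fun u v => (f₂ u v : ℝ) / (k + 1))
      (fun v => -((divergence f₁ v : ℤ) : ℝ) / (k + 1)) 0
      (fun v => by rw [hsc]; simp; ring) (fun v => by rw [hsc, hdiv]; simp; ring)
    have hround : ∀ a z : ℤ, 0 ≤ a → a ≤ k + 1 → ⌊(a : ℝ) / (k + 1)⌋ ≤ z → z ≤ ⌈(a : ℝ) / (k + 1)⌉ →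
        0 ≤ z ∧ z ≤ 1 ∧ (a = 0 → z = 0) ∧ 0 ≤ a - z ∧ a - z ≤ k := by
      intro a z h0 hk1 hlo hhi
      have h0' : (0 : ℝ) ≤ a := by exact_mod_cast h0
      have hk1' : (a : ℝ) ≤ k + 1 := by exact_mod_cast hk1
      have hz0 : 0 ≤ z := (Int.floor_nonneg.2 (div_nonneg h0' hk.le)).trans hlo
      have hz1 : z ≤ 1 := hhi.trans (Int.ceil_le.2 (by rw [div_le_iff₀ hk]; simpa using hk1'))
      have ha : a = 0 → z = 0 := by
        rintro rfl
        simp at hhi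
        omega
      -- A maximal entry scales to exactly 1 and must round to 1, so the remainder is bounded by k.
      have hmax : a = k + 1 → 1 ≤ z := by
        rintro rfl
        refine le_trans ?_ hlo
        rw [Int.le_floor, le_div_iff₀ hk]
        push_cast
        linarith
      refine ⟨hz0, hz1, ha, ?_, ?_⟩
      · rcases h0.eq_or_lt with h | h
        · rw [ha h.symm]; omega
        · omega
      · by_cases h : a = k + 1
        · have := hmax h; omega
        · omega
    have hr₁ := fun u v => hround (f₁ u v) (z₁ u v) (h₁ u v).1 (by exact_mod_cast (h₁ u v).2) (hz₁ u v).1 (hz₁ u v).2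
    have hr₂ := fun u v => hround (f₂ u v) (z₂ u v) (h₂ u v).1 (by exact_mod_cast (h₂ u v).2) (hz₂ u v).1 (hz₂ u v).2
    have hzdiv : divergence z₂ = divergence z₁ := by
      ext v
      have := hd₁ v
      have := hd₂ v
      omega
    have hrest := ih (f₁ - z₁) (f₂ - z₂) (fun u v => (hr₁ u v).2.2.2) (fun u v => (hr₂ u v).2.2.2)
      (by rw [divergence_sub, divergence_sub, hdiv, hzdiv])
    have hsum : divergence f₁ = divergence z₁ + divergence (f₁ - z₁) := by
      rw [divergence_sub]; abel
    rw [hsum]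
    refine add_mem (AddSubmonoid.subset_closure ⟨z₁, z₂, fun u v => ?_, fun u v => ?_, rfl, hzdiv⟩)
      (AddSubmonoid.closure_mono ?_ hrest)
    · exact ⟨(hr₁ u v).1, (hr₁ u v).2.1, (hr₁ u v).2.2.1⟩
    · exact ⟨(hr₂ u v).1, (hr₂ u v).2.1, (hr₂ u v).2.2.1⟩
    · rintro g ⟨y₁, y₂, hy₁, hy₂, hg₁, hg₂⟩
      exact ⟨y₁, y₂, fun u v => ⟨(hy₁ u v).1, (hy₁ u v).2.1, fun h =>
        (hy₁ u v).2.2 (by simp [h, (hr₁ u v).2.2.1 h])⟩, fun u v => ⟨(hy₂ u v).1, (hy₂ u v).2.1,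
        fun h => (hy₂ u v).2.2 (by simp [h, (hr₂ u v).2.2.1 h])⟩, hg₁, hg₂⟩

end Flow

/-! ### Lattice closure and normal cones -/

/-- A set closed under finite lattice operations and translations along the all-ones vector
contains every vector whose coordinate differences it dominates. -/
theorem mem_of_forall_exists_sub_le {ι R : Type*} [Fintype ι] [Nonempty ι] [AddCommGroup R]
    [LinearOrder R] [IsOrderedAddMonoid R] {S : Set (ι → R)}
    (hlat : ∀ x ∈ S, ∀ y ∈ S, x ⊔ y ∈ S ∧ x ⊓ y ∈ S)
    (hshift : ∀ x ∈ S, ∀ μ : R, (fun i => x i + μ) ∈ S) (z : ι → R)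
    (h : ∀ i j, ∃ d ∈ S, z i - z j ≤ d i - d j) : z ∈ S := by
  choose d hd hle using h
  -- Translated to agree with `z` at i, the witness for (i, j) is at most `z` at j. Thus z is the
  -- supremum over i of the infima over j.
  let e : ι → ι → ι → R := fun i j k => d i j k + (z i - d i j i)
  have he : ∀ i j, e i j ∈ S := fun i j => hshift _ (hd i j) _
  have hei : ∀ i j, e i j i = z i := fun i j => by simp [e]
  have hej : ∀ i j, e i j j ≤ z j := fun i j => by
    have := hle i j
    simp only [e]
    rw [sub_le_sub_iff] at this
    rw [← add_sub_assoc, sub_le_iff_le_add]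
    rwa [add_comm, add_comm (z j)]
  let g : ι → ι → R := fun i => Finset.univ.inf' Finset.univ_nonempty (e i)
  have hg : ∀ i, g i ∈ S := fun i =>
    Finset.inf'_mem S (fun x hx y hy => (hlat x hx y hy).2) _ _ _ fun j _ => he i j
  have hz : z = Finset.univ.sup' Finset.univ_nonempty g := by
    ext k
    rw [Finset.sup'_apply]
    apply le_antisymm
    · refine le_trans ?_ (Finset.le_sup' (fun i => g i k) (Finset.mem_univ k))
      simp only [g, Finset.inf'_apply]
      exact Finset.le_inf' _ _ fun j _ => (hei k j).ge
    · refine Finset.sup'_le _ _ fun i _ => ?_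
      simp only [g, Finset.inf'_apply]
      exact (Finset.inf'_le _ (Finset.mem_univ k)).trans (hej i k)
  rw [hz]
  exact Finset.sup'_mem S (fun x hx y hy => (hlat x hx y hy).1) _ _ _ fun i _ => hg i

theorem convex_solutionSet {m n : ℕ} (A : Matrix (Fin m) (Fin n) ℝ) (b : Fin m → ℝ) :
    Convex ℝ (solutionSet A b) := by
  intro x hx y hy s t hs ht hst i
  have h1 := mul_le_mul_of_nonneg_left (hx i) hs
  have h2 := mul_le_mul_of_nonneg_left (hy i) ht
  have h3 : b i = s * b i + t * b i := by rw [← add_mul, hst, one_mul]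
  simp only [mulVec_add, mulVec_smul, Pi.add_apply, Pi.smul_apply, smul_eq_mul]
  linarith

theorem IsPolyhedron.convex {n : ℕ} {P : Set (Fin n → ℝ)} (hP : IsPolyhedron P) : Convex ℝ P := by
  obtain ⟨m, A, b, rfl⟩ := hP
  exact convex_solutionSet A b

section NormalCone

variable {ι : Type*} [Fintype ι]

/-- The normal vectors of an L-convex set are the divergences of flows on the tight arcs. -/
theorem exists_flow_of_isMaxOn [Nonempty ι] {Q : Set (ι → ℝ)} (hconv : Convex ℝ Q)
    (hlat : ∀ x ∈ Q, ∀ y ∈ Q, x ⊔ y ∈ Q ∧ x ⊓ y ∈ Q)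
    (hshift : ∀ x ∈ Q, ∀ μ : ℝ, (fun i => x i + μ) ∈ Q) {x : ι → ℝ} (hx : x ∈ Q) {w : ι → ℝ}
    (hw : IsMaxOn (w ⬝ᵥ ·) Q x) :
    ∃ f : ι → ι → ℝ, (∀ i j, 0 ≤ f i j) ∧
      (∀ i j, f i j ≠ 0 → ∀ y ∈ Q, y i - y j ≤ x i - x j) ∧ divergence f = w := by
  classical
  let tight : ι → ι → Prop := fun i j => ∀ y ∈ Q, y i - y j ≤ x i - x j
  let A : Matrix (ι × ι) ι ℝ := Matrix.of fun p =>
    if tight p.1 p.2 then Pi.single p.1 1 - Pi.single p.2 1 else 0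
  obtain ⟨y, hy, hyA⟩ := exists_nonneg_vecMul_eq A w (by
    intro z hz
    have hz' : ∀ i j, tight i j → z i ≤ z j := fun i j hij => by
      have := hz (i, j)
      simp only [mulVec, A, of_apply, if_pos hij, sub_dotProduct, single_dotProduct, one_mul] at this
      linarith
    -- The cone of feasible directions at x. Convexity lets two directions share a step size, so the
    -- cone inherits the closure properties of `Q`.
    let T : Set (ι → ℝ) := {d | ∃ ε > (0 : ℝ), x + ε • d ∈ Q}
    have hshrink : ∀ d : ι → ℝ, ∀ ε δ : ℝ, 0 < δ → δ ≤ ε → x + ε • d ∈ Q → x + δ • d ∈ Q := by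
      intro d ε δ hδ hle h
      have hε : 0 < ε := hδ.trans_le hle
      have := hconv.add_smul_mem hx h (t := δ / ε)
        ⟨(div_pos hδ hε).le, (div_le_one hε).2 hle⟩
      rwa [smul_smul, div_mul_cancel₀ _ hε.ne'] at this
    have hzT : z ∈ T := by
      refine mem_of_forall_exists_sub_le ?_ ?_ z ?_
      · rintro d ⟨ε, hε, h⟩ d' ⟨ε', hε', h'⟩
        have hm : 0 < min ε ε' := lt_min hε hε'
        have hl := hlat _ (hshrink d ε _ hm (min_le_left _ _) h) _
          (hshrink d' ε' _ hm (min_le_right _ _) h')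
        refine ⟨⟨_, hm, ?_⟩, ⟨_, hm, ?_⟩⟩
        · convert hl.1 using 1
          ext i
          simp [mul_max_of_nonneg _ _ hm.le, max_add_add_left]
        · convert hl.2 using 1
          ext i
          simp [mul_min_of_nonneg _ _ hm.le, min_add_add_left]
      · rintro d ⟨ε, hε, h⟩ μ
        refine ⟨ε, hε, ?_⟩
        convert hshift _ h (ε * μ) using 1
        ext i
        simp
        ring
      · intro i j
        by_cases hij : tight i j
        · exact ⟨0, ⟨1, one_pos, by simpa using hx⟩, by simpa using hz' i j hij⟩
        · simp only [tight, not_forall, not_le] at hij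
          obtain ⟨v, hv, hlt⟩ := hij
          have hδ : 0 < (v i - v j) - (x i - x j) := by linarith
          have hc : 0 < (|z i - z j| + 1) / ((v i - v j) - (x i - x j)) := by positivity
          -- A point v violating tightness gives a direction v - x raising the difference of
          -- coordinates i and j; the factor makes this increase |zᵢ - zⱼ| + 1.
          refine ⟨((|z i - z j| + 1) / ((v i - v j) - (x i - x j))) • (v - x),
            ⟨_, inv_pos.2 hc, ?_⟩, ?_⟩
          · rw [smul_smul, inv_mul_cancel₀ hc.ne']
            simpa using hv
          · have h1 : (|z i - z j| + 1) / ((v i - v j) - (x i - x j)) *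
                ((v i - v j) - (x i - x j)) = |z i - z j| + 1 := div_mul_cancel₀ _ hδ.ne'
            simp only [Pi.smul_apply, Pi.sub_apply, smul_eq_mul]
            have := le_abs_self (z i - z j)
            linarith
    obtain ⟨ε, hε, h⟩ := hzT
    have h2 : w ⬝ᵥ (x + ε • z) ≤ w ⬝ᵥ x := isMaxOn_iff.1 hw _ h
    rw [dotProduct_add, dotProduct_smul, smul_eq_mul] at h2
    by_contra! hpos
    have := mul_pos hε hpos
    linarith)
  refine ⟨fun i j => if tight i j then y (i, j) else 0, fun i j => ?_, fun i j hij => ?_, ?_⟩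
  · dsimp only
    split_ifs
    exacts [hy _, le_rfl]
  · by_contra h
    exact hij (if_neg h)
  · rw [← hyA]
    ext v
    have h1 := sum_mul_divergence (fun i j => if tight i j then y (i, j) else 0) (Pi.single v 1)
    simp only [Pi.single_apply, mul_ite, mul_one, mul_zero, Finset.sum_ite_eq', Finset.mem_univ,
      if_true] at h1
    rw [h1, vecMul, dotProduct, Fintype.sum_prod_type]
    refine Finset.sum_congr rfl fun i _ => Finset.sum_congr rfl fun j _ => ?_
    simp only [A, of_apply]
    by_cases h : tight i j
    · simp [h, Pi.single_apply, eq_comm]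
    · simp [h]

end NormalCone

/-! ### Normal vectors of L♮- and L₂♮-convex polyhedra -/

section Polyhedra

variable {n : ℕ}

theorem snoc_zero_dotProduct (w : Fin (n + 1) → ℝ) (y : Fin n → ℝ) :
    w ⬝ᵥ (Fin.snoc y 0 : Fin (n + 1) → ℝ) = Fin.init w ⬝ᵥ y := by
  simp [dotProduct, Fin.sum_univ_castSucc, Fin.init]

/-- The extension of a vector by the coordinate that makes the sum of all coordinates zero. -/
def balance {R : Type*} [AddCommGroup R] (w : Fin n → R) : Fin (n + 1) → R :=
  Fin.snoc w (-∑ i, w i)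

/-- The normal vectors of an L♮-convex polyhedron as divergences of flows. -/
theorem IsLNatConvexPolyhedron.exists_tight {P : Set (Fin n → ℝ)} (hP : IsLNatConvexPolyhedron P)
    {x : Fin n → ℝ} (hx : x ∈ P) : ∃ tight : Fin (n + 1) → Fin (n + 1) → Prop,
      (∀ w : Fin n → ℝ, IsMaxOn (w ⬝ᵥ ·) P x → ∃ f : Fin (n + 1) → Fin (n + 1) → ℝ,
        (∀ i j, 0 ≤ f i j) ∧ (∀ i j, f i j ≠ 0 → tight i j) ∧ divergence f = balance w) ∧
      ∀ f : Fin (n + 1) → Fin (n + 1) → ℝ, (∀ i j, 0 ≤ f i j) →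
        (∀ i j, f i j ≠ 0 → tight i j) → IsMaxOn (Fin.init (divergence f) ⬝ᵥ ·) P x := by
  obtain ⟨-, Q, ⟨hQ, hlat, hshift⟩, rfl⟩ := hP
  refine ⟨fun i j => ∀ y ∈ Q, y i - y j ≤ (Fin.snoc x 0 : Fin (n + 1) → ℝ) i -
    (Fin.snoc x 0 : Fin (n + 1) → ℝ) j, fun w hw => ?_, fun f hf ht => ?_⟩
  · refine exists_flow_of_isMaxOn hQ.convex hlat hshift hx (isMaxOn_iff.2 fun y hy => ?_)
    -- Every point of `Q` translates to last coordinate 0, and `balance w` annihilates the all-ones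
    -- vector, so maximality passes from the section to `Q`.
    have h1 := hshift y hy (-y (Fin.last n))
    have h2 : (fun i => y i + -y (Fin.last n)) =
        (Fin.snoc (fun i : Fin n => y i.castSucc - y (Fin.last n)) 0 : Fin (n + 1) → ℝ) := by
      ext i
      refine Fin.lastCases ?_ (fun i => ?_) i <;> simp [sub_eq_add_neg]
    rw [h2] at h1
    have h3 : w ⬝ᵥ (fun i : Fin n => y i.castSucc - y (Fin.last n)) ≤ w ⬝ᵥ x :=
      isMaxOn_iff.1 hw _ h1
    simp only [balance, snoc_zero_dotProduct, Fin.init_snoc]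
    refine le_trans (le_of_eq ?_) h3
    simp only [dotProduct, Fin.sum_univ_castSucc, mul_sub, Finset.sum_sub_distrib,
      ← Finset.sum_mul, Fin.snoc_castSucc, Fin.snoc_last]
    ring
  · refine isMaxOn_iff.2 fun y hy => ?_
    simp only [← snoc_zero_dotProduct]
    simp only [dotProduct, sum_mul_divergence]
    refine Finset.sum_le_sum fun i _ => Finset.sum_le_sum fun j _ => ?_
    by_cases h : f i j = 0
    · simp [h]
    · exact mul_le_mul_of_nonneg_left (ht i j h _ hy) (hf i j)

/-- The integral vectors of bounded size that are maximized over `P` at `x`. -/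
def smallNormals (P : Set (Fin n → ℝ)) (x : Fin n → ℝ) : Set (Fin n → ℤ) :=
  {g | (∀ i, |g i| ≤ n + 1) ∧ IsMaxOn ((fun i => (g i : ℝ)) ⬝ᵥ ·) P x}

/-- If an integral vector differs from a normal vector of an L₂♮-convex polyhedron by `s`, then
`s` can be rounded such that the difference is a sum of small integral normal vectors. -/
theorem exists_rounding_mem_closure {P₁ P₂ : Set (Fin n → ℝ)} (h₁ : IsLNatConvexPolyhedron P₁)
    (h₂ : IsLNatConvexPolyhedron P₂) {x : Fin n → ℝ} (hx : x ∈ P₁ + P₂) (w : Fin n → ℤ)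
    (s : Fin n → ℝ) (hw : IsMaxOn ((fun i => (w i : ℝ) - s i) ⬝ᵥ ·) (P₁ + P₂) x) :
    ∃ r : Fin n → ℤ, (∀ i, ⌊s i⌋ ≤ r i ∧ r i ≤ ⌈s i⌉) ∧
      w - r ∈ AddSubmonoid.closure (smallNormals (P₁ + P₂) x) := by
  obtain ⟨x₁, hx₁, x₂, hx₂, rfl⟩ := hx
  obtain ⟨t₁, hflow₁, hmax₁⟩ := h₁.exists_tight hx₁
  obtain ⟨t₂, hflow₂, hmax₂⟩ := h₂.exists_tight hx₂
  rw [isMaxOn_iff] at hw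
  simp only [dotProduct_add] at hw
  obtain ⟨f₁, hf₁, hs₁, hd₁⟩ := hflow₁ (fun i => (w i : ℝ) - s i) (isMaxOn_iff.2 fun y hy => by
    have := hw _ (Set.add_mem_add hy hx₂)
    rw [dotProduct_add] at this
    linarith)
  obtain ⟨f₂, hf₂, hs₂, hd₂⟩ := hflow₂ (fun i => (w i : ℝ) - s i) (isMaxOn_iff.2 fun y hy => by
    have := hw _ (Set.add_mem_add hx₁ hy)
    rw [dotProduct_add] at this
    linarith)
  have hbal : ∀ v, balance (fun i => (w i : ℝ) - s i) v + balance s v = (balance w v : ℤ) := by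
    intro v
    refine Fin.lastCases ?_ (fun i => ?_) v
    · simp [balance]
      ring
    · simp [balance]
  obtain ⟨g₁, g₂, r, hg₁, hg₂, hr, hgd₁, hgd₂⟩ := exists_rounded_flow_pair f₁ f₂ (balance s)
    (balance w) (fun v => by rw [hd₁, hbal]) (fun v => by rw [hd₂, hbal])
  have hnn₁ : ∀ u v, 0 ≤ g₁ u v := fun u v => (Int.floor_nonneg.2 (hf₁ u v)).trans (hg₁ u v).1
  have hnn₂ : ∀ u v, 0 ≤ g₂ u v := fun u v => (Int.floor_nonneg.2 (hf₂ u v)).trans (hg₂ u v).1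
  have hg0₁ : ∀ u v, f₁ u v = 0 → g₁ u v = 0 := fun u v h => by
    have := hg₁ u v
    simp [h] at this
    omega
  have hg0₂ : ∀ u v, f₂ u v = 0 → g₂ u v = 0 := fun u v h => by
    have := hg₂ u v
    simp [h] at this
    omega
  obtain ⟨k, hk⟩ : ∃ k : ℕ, ∀ u v, g₁ u v ≤ k ∧ g₂ u v ≤ k := by
    refine ⟨∑ u, ∑ v, ((g₁ u v).toNat + (g₂ u v).toNat), fun u v => ?_⟩
    have h1 := Finset.single_le_sum (f := fun v => (g₁ u v).toNat + (g₂ u v).toNat)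
      (fun _ _ => Nat.zero_le _) (Finset.mem_univ v)
    have h2 := Finset.single_le_sum (f := fun u => ∑ v, ((g₁ u v).toNat + (g₂ u v).toNat))
      (fun _ _ => Nat.zero_le _) (Finset.mem_univ u)
    omega
  have hcl := divergence_mem_closure k g₁ g₂ (fun u v => ⟨hnn₁ u v, (hk u v).1⟩)
    (fun u v => ⟨hnn₂ u v, (hk u v).2⟩) (by
      ext v
      have := hgd₁ v
      have := hgd₂ v
      omega)
  let ρ : (Fin (n + 1) → ℤ) →+ (Fin n → ℤ) :=
    { toFun := Fin.init, map_zero' := rfl, map_add' := fun _ _ => rfl }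
  refine ⟨fun i => r i.castSucc, fun i => by simpa [balance] using hr i.castSucc, ?_⟩
  have hρ : w - (fun i => r i.castSucc) = ρ (divergence g₁) := by
    ext i
    have := hgd₁ i.castSucc
    simp [balance] at this
    change w i - r i.castSucc = divergence g₁ i.castSucc
    omega
  rw [hρ]
  have hmap := AddSubmonoid.mem_map_of_mem ρ hcl
  rw [AddMonoidHom.map_mclosure] at hmap
  refine AddSubmonoid.closure_mono ?_ hmap
  rintro _ ⟨g, ⟨z₁, z₂, hz₁, hz₂, rfl, hzz⟩, rfl⟩
  have hcast : ∀ z : Fin (n + 1) → Fin (n + 1) → ℤ, (fun i => ((ρ (divergence z) i : ℤ) : ℝ)) =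
      Fin.init (divergence fun u v => (z u v : ℝ)) := fun z => by
    ext i
    exact intCast_divergence z i.castSucc
  -- The two 0-1 flows are supported on tight arcs of the respective summands, so their common
  -- divergence is maximized at x₁ and at x₂.
  refine ⟨fun i => ?_, isMaxOn_iff.2 ?_⟩
  · have := abs_divergence_le (fun u v => (hz₁ u v).1) (fun u v => (hz₁ u v).2.1) i.castSucc
    rw [Fintype.card_fin] at this
    exact_mod_cast this
  · rintro _ ⟨y₁, hy₁, y₂, hy₂, rfl⟩
    have e₁ := isMaxOn_iff.1 (hmax₁ (fun u v => (z₁ u v : ℝ)) (fun u v => by exact_mod_cast (hz₁ u v).1)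
      fun u v h => hs₁ u v fun h' => h (by exact_mod_cast (hz₁ u v).2.2 (hg0₁ u v h'))) y₁ hy₁
    have e₂ := isMaxOn_iff.1 (hmax₂ (fun u v => (z₂ u v : ℝ)) (fun u v => by exact_mod_cast (hz₂ u v).1)
      fun u v h => hs₂ u v fun h' => h (by exact_mod_cast (hz₂ u v).2.2 (hg0₂ u v h'))) y₂ hy₂
    rw [← hcast] at e₁ e₂
    rw [hzz] at e₂
    simp only [dotProduct_add]
    exact add_le_add e₁ e₂

/-! ### The box-TDI system of small normals -/

theorem ratCast_mem_fieldRange (q : ℚ) : (q : ℝ) ∈ (Rat.castHom ℝ).fieldRange := ⟨q, rfl⟩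

theorem isPolyOver_ratSolutionSet {m : ℕ} (A : Matrix (Fin m) (Fin n) ℚ) (b : Fin m → ℚ) :
    IsPolyOver (Rat.castHom ℝ).fieldRange (ratSolutionSet A b) := by
  have := IsPolyOver.iInter (F := (Rat.castHom ℝ).fieldRange)
    (P := fun i => {x : Fin n → ℝ | (fun j => (A i j : ℝ)) ⬝ᵥ x ≤ b i})
    fun i => IsPolyOver.halfspace (fun j => ratCast_mem_fieldRange _) (ratCast_mem_fieldRange _)
  convert this using 1
  ext x
  simp [ratSolutionSet, solutionSet, mulVec]

theorem IsPolyOver.isRationalPolyhedron {P : Set (Fin n → ℝ)}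
    (hP : IsPolyOver (Rat.castHom ℝ).fieldRange P) : IsRationalPolyhedron P := by
  obtain ⟨s, hs, hsF, rfl⟩ := hP
  have := hs.to_subtype
  obtain ⟨m, ⟨e⟩⟩ := Finite.exists_equiv_fin s
  have h1 : ∀ (k : Fin m) (i : Fin n), ∃ q : ℚ, (q : ℝ) = (e.symm k).1.1 i := fun k i =>
    (hsF _ (e.symm k).2).1 i
  have h2 : ∀ k : Fin m, ∃ q : ℚ, (q : ℝ) = (e.symm k).1.2 := fun k => (hsF _ (e.symm k).2).2
  choose A hA using h1
  choose b hb using h2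
  refine ⟨m, Matrix.of A, b, ?_⟩
  ext x
  have h3 : ∀ k, (((Matrix.of A).map fun q : ℚ => (q : ℝ)) *ᵥ x) k = (e.symm k).1.1 ⬝ᵥ x := by
    intro k
    simp [mulVec, dotProduct, hA]
  simp only [ratSolutionSet, solutionSet, Set.mem_ofPred_eq, h3, hb]
  exact ⟨fun h k => h _ (e.symm k).2, fun h c hc => by simpa using h (e ⟨c, hc⟩)⟩

theorem IsRationalPolyhedron.isPolyhedron {P : Set (Fin n → ℝ)} (hP : IsRationalPolyhedron P) :
    IsPolyhedron P := by
  obtain ⟨m, A, b, rfl⟩ := hP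
  exact ⟨m, _, _, rfl⟩

theorem exists_pos_mul_eq_intCast (a : Fin n → ℚ) :
    ∃ N : ℕ, 0 < N ∧ ∃ w : Fin n → ℤ, ∀ i, (w i : ℚ) = N * a i := by
  refine ⟨∏ i, (a i).den, Finset.prod_pos fun i _ => (a i).pos, fun i =>
    (∏ j ∈ Finset.univ.erase i, (a j).den : ℕ) * (a i).num, fun i => ?_⟩
  rw [← Finset.mul_prod_erase _ _ (Finset.mem_univ i)]
  push_cast
  rw [mul_comm ((a i).den : ℚ), mul_assoc, Rat.den_mul_eq_num]

/-- The system 0 ≤ -1 works: raising its multiplier lowers the dual value and preserves feasibility,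
so no dual optimum exists and the condition is vacuous. -/
theorem isBoxTDIPolyhedron_empty : IsBoxTDIPolyhedron (∅ : Set (Fin n → ℝ)) := by
  refine ⟨1, 0, fun _ => -1, ?_, ?_⟩
  · rintro c d w ⟨y, ⟨hy, hyw⟩, hopt⟩
    exfalso
    have := hopt (y + Pi.single (Sum.inl 0) 1)
      ⟨fun i => add_nonneg (hy i)
        (by rw [Pi.single_apply]; split_ifs <;> norm_num), fun j => by
        rw [← hyw j]
        simp [Fintype.sum_sum_type]⟩
    simp [Fintype.sum_sum_type] at this
    linarith
  · ext x
    simp [ratSolutionSet, solutionSet]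

/-- The rational system of all small integral inequalities that are valid and tight for a nonempty
rational polyhedron. -/
theorem exists_smallSystem {P : Set (Fin n → ℝ)} (hP : IsRationalPolyhedron P) (hne : P.Nonempty) :
    ∃ (m : ℕ) (A : Matrix (Fin m) (Fin n) ℤ) (b : Fin m → ℚ),
      (∀ k, IsGreatest ((fun x => (fun j => (A k j : ℝ)) ⬝ᵥ x) '' P) (b k)) ∧
      ∀ x ∈ P, ∀ g ∈ smallNormals P x, ∃ k, A k = g := by
  let S : Set (Fin n → ℤ) := {g | (∀ i, |g i| ≤ n + 1) ∧
    BddAbove ((fun x => (fun j => (g j : ℝ)) ⬝ᵥ x) '' P)}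
  have hS : S.Finite := (Set.finite_Icc (fun _ => -(n + 1 : ℤ)) (fun _ => (n + 1 : ℤ))).subset
    fun g hg => ⟨fun i => (abs_le.1 (hg.1 i)).1, fun i => (abs_le.1 (hg.1 i)).2⟩
  have := hS.to_subtype
  obtain ⟨m, ⟨e⟩⟩ := Finite.exists_equiv_fin S
  have hb : ∀ k : Fin m, ∃ b : ℚ,
      IsGreatest ((fun x => (fun j => ((e.symm k).1 j : ℝ)) ⬝ᵥ x) '' P) (b : ℝ) := fun k => by
    obtain ⟨m', A', b', rfl⟩ := hP
    obtain ⟨_, ⟨b, rfl⟩, h⟩ := (isPolyOver_ratSolutionSet A' b').exists_isGreatest hne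
      (g := fun j => ((e.symm k).1 j : ℝ))
      (fun j => by simp) (e.symm k).2.2
    exact ⟨b, h⟩
  choose b hb using hb
  refine ⟨m, fun k => (e.symm k).1, b, hb, fun x _ g hg => ⟨e ⟨g, hg.1, ?_⟩, by simp⟩⟩
  exact ⟨_, Set.forall_mem_image.2 (isMaxOn_iff.1 hg.2)⟩

/-- Each inequality defining P, scaled to an integral w, attains its maximum at some x₀ in P. There
w is a sum of small normals, whose inequalities add up to w · x ≤ w · x₀. -/
theorem ratSolutionSet_smallSystem {P P₁ P₂ : Set (Fin n → ℝ)} (h₁ : IsLNatConvexPolyhedron P₁)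
    (h₂ : IsLNatConvexPolyhedron P₂) (hsum : P = P₁ + P₂) (hP : IsRationalPolyhedron P)
    (hne : P.Nonempty) {m : ℕ} {A : Matrix (Fin m) (Fin n) ℤ} {b : Fin m → ℚ}
    (hb : ∀ k, IsGreatest ((fun x => (fun j => (A k j : ℝ)) ⬝ᵥ x) '' P) (b k))
    (hA : ∀ x ∈ P, ∀ g ∈ smallNormals P x, ∃ k, A k = g) :
    P = ratSolutionSet (A.map fun z : ℤ => (z : ℚ)) b := by
  have hmem : ∀ x, x ∈ ratSolutionSet (A.map fun z : ℤ => (z : ℚ)) b ↔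
      ∀ k, (fun j => (A k j : ℝ)) ⬝ᵥ x ≤ b k := fun x => by
    simp [ratSolutionSet, solutionSet, mulVec]
  refine Set.Subset.antisymm (fun x hx => (hmem x).2 fun k => (hb k).2 ⟨x, hx, rfl⟩)
    fun x hx => ?_
  rw [hmem] at hx
  obtain ⟨m', A', b', hPeq⟩ := hP
  have hpoly := isPolyOver_ratSolutionSet A' b'
  rw [← hPeq] at hpoly
  rw [hPeq]
  intro k
  obtain ⟨N, hN, w, hw⟩ := exists_pos_mul_eq_intCast (A' k)
  have hN' : (0 : ℝ) < N := by exact_mod_cast hN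
  have hwx : ∀ y : Fin n → ℝ, (fun j => (w j : ℝ)) ⬝ᵥ y =
      N * ((A'.map fun q : ℚ => (q : ℝ)) *ᵥ y) k := fun y => by
    simp only [mulVec, dotProduct, Finset.mul_sum, map_apply, ← mul_assoc]
    refine Finset.sum_congr rfl fun j _ => ?_
    have : (w j : ℝ) = N * A' k j := by exact_mod_cast hw j
    rw [this]
  have hbound : ∀ y ∈ P, (fun j => (w j : ℝ)) ⬝ᵥ y ≤ N * b' k := fun y hy => by
    rw [hwx]
    rw [hPeq] at hy
    exact mul_le_mul_of_nonneg_left (hy k) hN'.le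
  obtain ⟨-, -, ⟨x₀, hx₀, rfl⟩, hmax⟩ := hpoly.exists_isGreatest hne (g := fun j => (w j : ℝ))
    (fun j => by simp)
    ⟨_, Set.forall_mem_image.2 hbound⟩
  have hmax' : IsMaxOn ((fun j => (w j : ℝ)) ⬝ᵥ ·) P x₀ :=
    isMaxOn_iff.2 fun y hy => hmax ⟨y, hy, rfl⟩
  -- With s = 0 the rounding is forced to be r = 0.
  obtain ⟨r, hr, hcl⟩ := exists_rounding_mem_closure h₁ h₂ (hsum ▸ hx₀) w 0 (by
    simpa [← hsum] using hmax')
  have hr0 : r = 0 := by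
    ext i
    have := hr i
    simp at this ⊢
    omega
  rw [hr0, sub_zero, ← hsum] at hcl
  have hle : (fun j => (w j : ℝ)) ⬝ᵥ x ≤ (fun j => (w j : ℝ)) ⬝ᵥ x₀ := by
    clear hmax hmax' hbound hwx hw
    induction hcl using AddSubmonoid.closure_induction with
    | mem g hg =>
      obtain ⟨k, rfl⟩ := hA x₀ hx₀ g hg
      obtain ⟨z, hz, hzb⟩ := (hb k).1
      exact (hx k).trans (hzb ▸ isMaxOn_iff.1 hg.2 z hz)
    | zero => simp [dotProduct]
    | add p q _ _ hp hq =>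
      have : (fun j => (((p + q) j : ℤ) : ℝ)) = (fun j => (p j : ℝ)) + fun j => (q j : ℝ) := by
        ext j; simp
      rw [this, add_dotProduct, add_dotProduct]
      exact add_le_add hp hq
  have := hle.trans (hbound x₀ hx₀)
  rw [hwx] at this
  exact le_of_mul_le_mul_left this hN'

/-- At a primal point x complementary to the dual optimum, w - s is normal to P, where s is the net
box multiplier. Rounding s makes the difference a nonnegative integral combination of rows tight at
x. -/
theorem isBoxTDI_smallSystem {P P₁ P₂ : Set (Fin n → ℝ)} (h₁ : IsLNatConvexPolyhedron P₁)
    (h₂ : IsLNatConvexPolyhedron P₂) (hsum : P = P₁ + P₂)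
    {m : ℕ} {A : Matrix (Fin m) (Fin n) ℤ} {b : Fin m → ℚ}
    (hb : ∀ k, IsGreatest ((fun x => (fun j => (A k j : ℝ)) ⬝ᵥ x) '' P) (b k))
    (hA : ∀ x ∈ P, ∀ g ∈ smallNormals P x, ∃ k, A k = g)
    (hP : P = ratSolutionSet (A.map fun z : ℤ => (z : ℚ)) b) :
    IsBoxTDI (A.map fun z : ℤ => (z : ℚ)) b := by
  classical
  rintro c d w ⟨y, ⟨hy, hyw⟩, hopt⟩
  set B : Fin m ⊕ (Fin n ⊕ Fin n) → ℚ := Sum.elim b (Sum.elim c (-d)) with hB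
  set M : Matrix (Fin m ⊕ (Fin n ⊕ Fin n)) (Fin n) ℚ := Matrix.fromRows (A.map fun z : ℤ => (z : ℚ))
    (Matrix.fromRows (1 : Matrix (Fin n) (Fin n) ℚ) (-1)) with hM
  let M' : Matrix (Fin m ⊕ (Fin n ⊕ Fin n)) (Fin n) ℝ := M.map fun q : ℚ => (q : ℝ)
  have hfeas : ∀ z : Fin m ⊕ (Fin n ⊕ Fin n) → ℝ, IsDualFeasible M w z ↔
      (∀ i, 0 ≤ z i) ∧ z ᵥ* M' = fun j => (w j : ℝ) := fun z =>
    and_congr_right fun _ => ⟨fun h => funext h, fun h => congrFun h⟩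
  have hM'eq : ∀ z : Fin m ⊕ (Fin n ⊕ Fin n) → ℝ, ∀ j, (z ᵥ* M') j =
      ∑ k, z (Sum.inl k) * (A k j : ℝ) + (z (Sum.inr (Sum.inl j)) - z (Sum.inr (Sum.inr j))) := by
    intro z j
    simp [vecMul, dotProduct, M', hM, Fintype.sum_sum_type, Matrix.one_apply, apply_ite,
      sub_eq_add_neg]
  have hyM := ((hfeas y).1 ⟨hy, hyw⟩).2
  obtain ⟨x, hx, htight⟩ := exists_primal_of_dual_optimal M' (fun i => (B i : ℝ)) y hy
    fun z hz hzy => hopt z ((hfeas z).2 ⟨hz, hzy.trans hyM⟩)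
  have e₁ : ∀ k, (M' *ᵥ x) (Sum.inl k) = (fun j => (A k j : ℝ)) ⬝ᵥ x := fun k => by
    simp [mulVec, dotProduct, M', hM]
  have e₂ : ∀ j, (M' *ᵥ x) (Sum.inr (Sum.inl j)) = x j := fun j => by
    simp [mulVec, dotProduct, M', hM, Matrix.one_apply, apply_ite]
  have e₃ : ∀ j, (M' *ᵥ x) (Sum.inr (Sum.inr j)) = -x j := fun j => by
    simp [mulVec, dotProduct, M', hM, Matrix.one_apply, apply_ite]
  have hxP : x ∈ P := by
    rw [hP]
    intro k
    have := hx (Sum.inl k)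
    rw [e₁] at this
    simpa [hB, mulVec] using this
  let s : Fin n → ℝ := fun j => y (Sum.inr (Sum.inl j)) - y (Sum.inr (Sum.inr j))
  have hws : (fun j => (w j : ℝ) - s j) = fun j => ∑ k, y (Sum.inl k) * (A k j : ℝ) := by
    ext j
    have := congrFun hyM j
    rw [hM'eq] at this
    simp only [s]
    linarith
  have hdot : ∀ z : Fin n → ℝ, (fun j => (w j : ℝ) - s j) ⬝ᵥ z =
      ∑ k, y (Sum.inl k) * ((fun j => (A k j : ℝ)) ⬝ᵥ z) := fun z => by
    rw [hws]
    simp only [dotProduct, Finset.sum_mul, Finset.mul_sum, mul_assoc]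
    exact Finset.sum_comm
  have hnormal : IsMaxOn ((fun j => (w j : ℝ) - s j) ⬝ᵥ ·) P x := by
    refine isMaxOn_iff.2 fun z hz => ?_
    rw [hdot, hdot]
    refine Finset.sum_le_sum fun k _ => ?_
    rcases (hy (Sum.inl k)).eq_or_lt with h | h
    · simp [← h]
    · have := htight _ h
      rw [e₁] at this
      rw [this]
      exact mul_le_mul_of_nonneg_left ((hb k).2 ⟨z, hz, rfl⟩) h.le
  obtain ⟨r, hr, hcl⟩ := exists_rounding_mem_closure h₁ h₂ (hsum ▸ hxP) w s (hsum ▸ hnormal)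
  rw [← hsum] at hcl
  have hcomb : ∀ p ∈ AddSubmonoid.closure (smallNormals P x), ∃ l : Fin m → ℤ, (∀ k, 0 ≤ l k) ∧
      (∀ k, l k ≠ 0 → (fun j => (A k j : ℝ)) ⬝ᵥ x = b k) ∧ ∀ j, ∑ k, l k * A k j = p j := by
    intro p hp
    induction hp using AddSubmonoid.closure_induction with
    | mem g hg =>
      obtain ⟨k, rfl⟩ := hA x hxP g hg
      refine ⟨Pi.single k 1, fun i => by
        rw [Pi.single_apply]; split_ifs <;> norm_num, fun i hi => ?_, fun j => ?_⟩
      · obtain rfl : i = k := by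
          by_contra h
          exact hi (Pi.single_eq_of_ne h _)
        obtain ⟨z, hz, hzb⟩ := (hb i).1
        exact le_antisymm ((hb i).2 ⟨x, hxP, rfl⟩) (hzb ▸ isMaxOn_iff.1 hg.2 z hz)
      · simp [Pi.single_apply]
    | zero => exact ⟨0, by simp, by simp, by simp⟩
    | add p q _ _ hp hq =>
      obtain ⟨l, hl, hlt, hlp⟩ := hp
      obtain ⟨l', hl', hlt', hlp'⟩ := hq
      refine ⟨l + l', fun k => add_nonneg (hl k) (hl' k), fun k hk => ?_, fun j => ?_⟩
      · by_cases h : l k = 0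
        · exact hlt' k fun h' => hk (by simp [h, h'])
        · exact hlt k h
      · simp [add_mul, Finset.sum_add_distrib, hlp, hlp']
  obtain ⟨l, hl, hlt, hlw⟩ := hcomb _ hcl
  -- The positive and negative parts of r. Since r lies between ⌊s⌋ and ⌈s⌉, a nonzero part means s
  -- has the same strict sign, so the matching box constraint is tight.
  let z : Fin m ⊕ (Fin n ⊕ Fin n) → ℤ :=
    Sum.elim l (Sum.elim (fun j => max (r j) 0) (fun j => max (-r j) 0))
  have hz0 : ∀ i, 0 ≤ (z i : ℝ) := by
    rintro (k | j | j)
    · exact_mod_cast hl k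
    · exact_mod_cast le_max_right _ _
    · exact_mod_cast le_max_right _ _
  have hzM : (fun i => (z i : ℝ)) ᵥ* M' = fun j => (w j : ℝ) := by
    ext j
    rw [hM'eq]
    have h1 : max (r j) 0 - max (-r j) 0 = r j := by omega
    have h2 : ∑ k, l k * A k j + (max (r j) 0 - max (-r j) 0) = w j := by
      rw [hlw, h1]; simp
    exact_mod_cast h2
  have hzt : ∀ i, z i ≠ 0 → (M' *ᵥ x) i = B i := by
    rintro (k | j | j) hi
    · rw [e₁]
      exact hlt k hi
    · refine htight _ ?_
      have h1 : 0 < r j := by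
        by_contra h
        exact hi (max_eq_right (not_lt.1 h))
      have h2 : 0 < s j := Int.ceil_pos.1 (h1.trans_le (hr j).2)
      have := hy (Sum.inr (Sum.inr j))
      simp only [s] at h2
      linarith
    · refine htight _ ?_
      have h1 : r j < 0 := by
        by_contra h
        exact hi (max_eq_right (by omega))
      have h2 : s j < 0 := by
        have := (hr j).1.trans_lt h1
        rwa [Int.floor_lt, Int.cast_zero] at this
      have := hy (Sum.inr (Sum.inl j))
      simp only [s] at h2
      linarith
  refine ⟨z, (hfeas _).2 ⟨hz0, hzM⟩, fun z' hz' => ?_⟩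
  obtain ⟨hz'0, hz'M⟩ := (hfeas z').1 hz'
  have h1 : ∑ i, (z i : ℝ) * (B i : ℝ) = (fun i => (z i : ℝ)) ⬝ᵥ (M' *ᵥ x) := by
    refine Finset.sum_congr rfl fun i _ => ?_
    by_cases h : z i = 0
    · simp [h]
    · rw [hzt i h]
  rw [h1, dotProduct_mulVec, hzM, ← hz'M, ← dotProduct_mulVec]
  exact Finset.sum_le_sum fun i _ => mul_le_mul_of_nonneg_left (hx i) (hz'0 i)

/-- Every rational L₂♮-convex polyhedron is a box-TDI polyhedron. -/
theorem IsL2NatConvexPolyhedron.isBoxTDIPolyhedron {P : Set (Fin n → ℝ)}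
    (h : IsL2NatConvexPolyhedron P) (hrat : IsRationalPolyhedron P) : IsBoxTDIPolyhedron P := by
  rcases P.eq_empty_or_nonempty with rfl | hne
  · exact isBoxTDIPolyhedron_empty
  obtain ⟨-, P₁, P₂, h₁, h₂, hsum⟩ := h
  obtain ⟨m, A, b, hb, hA⟩ := exists_smallSystem hrat hne
  have hP := ratSolutionSet_smallSystem h₁ h₂ hsum hrat hne hb hA
  exact ⟨m, _, b, isBoxTDI_smallSystem h₁ h₂ hsum hb hA hP, hP⟩

/-! ### Convex hulls of integral L-convex sets -/

open MeasureTheory in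
theorem integral_Ioc_floor_add (a : ℝ) : ∫ t in Set.Ioc (0 : ℝ) 1, (⌊a + t⌋ : ℝ) = a := by
  have h1 : Set.EqOn (fun t : ℝ => (⌊a + t⌋ : ℝ))
      (fun t => (⌊a⌋ : ℝ) + (Set.Ici (1 - Int.fract a)).indicator (fun _ => 1) t) (Set.Ioc 0 1) := by
    rintro t ⟨h0, h1⟩
    have hf := Int.floor_add_fract a
    have hf0 := Int.fract_nonneg a
    have hf1 := Int.fract_lt_one a
    by_cases h : 1 - Int.fract a ≤ t
    · have : ⌊a + t⌋ = ⌊a⌋ + 1 := by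
        rw [Int.floor_eq_iff]; push_cast; constructor <;> linarith
      simp [h, this]
    · have : ⌊a + t⌋ = ⌊a⌋ := by
        rw [Int.floor_eq_iff]; push Not at h; constructor <;> linarith
      simp [h, this]
  have hf0 := Int.fract_nonneg a
  have hf1 := Int.fract_lt_one a
  have h2 : Set.Ioc (0 : ℝ) 1 ∩ Set.Ici (1 - Int.fract a) = Set.Icc (1 - Int.fract a) 1 := by
    ext t
    simp only [Set.mem_inter_iff, Set.mem_Ioc, Set.mem_Ici, Set.mem_Icc]
    constructor
    · rintro ⟨⟨_, h⟩, h'⟩; exact ⟨h', h⟩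
    · rintro ⟨h', h⟩; exact ⟨⟨by linarith, h⟩, h'⟩
  rw [setIntegral_congr_fun measurableSet_Ioc h1, integral_add (integrable_const _)
    ((integrable_const _).indicator measurableSet_Ici), setIntegral_indicator measurableSet_Ici, h2]
  simp [hf0]

/-- The floor is monotone and commutes with integer translations, so it preserves integer bounds on
coordinate differences; these bounds determine membership in S. -/
theorem floor_mem_of_isLConvexSet {S : Set (Fin n → ℤ)} (hS : IsLConvexSet S) {x : Fin n → ℝ}
    (hx : ∀ (i j : Fin n) (γ : ℤ), (∀ s ∈ S, s i - s j ≤ γ) → x i - x j ≤ γ) :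
    (fun i => ⌊x i⌋) ∈ S := by
  obtain ⟨⟨s₀, hs₀⟩, hlat, hshift⟩ := hS
  rcases isEmpty_or_nonempty (Fin n) with h | h
  · rwa [Subsingleton.elim (fun i => ⌊x i⌋) s₀]
  refine mem_of_forall_exists_sub_le hlat hshift _ fun i j => ?_
  by_contra! hlt
  have h1 := hx i j (⌊x i⌋ - ⌊x j⌋ - 1) fun s hs => by have := hlt s hs; omega
  push_cast at h1
  have h2 : ⌊x i⌋ ≤ ⌊x j + (⌊x i⌋ - ⌊x j⌋ - 1 : ℤ)⌋ :=
    Int.floor_le_floor (by push_cast; linarith)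
  rw [Int.floor_add_intCast] at h2
  omega

/-- Randomized rounding: x is the mean of ⌊x + t𝟏⌋ for t uniform in (0, 1], and every such vector
belongs to S. -/
theorem integerHull_eq_of_isLConvexSet {S : Set (Fin n → ℤ)} (hS : IsLConvexSet S) :
    integerHull S = {x : Fin n → ℝ | ∀ (i j : Fin n) (γ : ℤ), (∀ s ∈ S, s i - s j ≤ γ) →
      x i - x j ≤ γ} := by
  refine Set.Subset.antisymm (convexHull_min ?_ ?_) fun x hx => ?_
  · rintro _ ⟨s, hs, rfl⟩ i j γ h
    have := h s hs
    dsimp only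
    exact_mod_cast this
  · intro x hx y hy a b ha hb hab i j γ h
    have h1 := mul_le_mul_of_nonneg_left (hx i j γ h) ha
    have h2 := mul_le_mul_of_nonneg_left (hy i j γ h) hb
    have h3 : (γ : ℝ) = a * γ + b * γ := by rw [← add_mul, hab, one_mul]
    simp only [Pi.add_apply, Pi.smul_apply, smul_eq_mul]
    linarith
  · have hmem : ∀ t : ℝ, (fun i => ⌊x i + t⌋) ∈ S := fun t =>
      floor_mem_of_isLConvexSet hS fun i j γ h => by simpa using hx i j γ h
    -- Only finitely many roundings occur, so their hull is closed and contains the mean.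
    let R : Set (Fin n → ℤ) := S ∩ Set.Icc (fun i => ⌊x i⌋) (fun i => ⌊x i⌋ + 1)
    have hR : R.Finite := (Set.finite_Icc _ _).inter_of_right _
    let p : ℝ → Fin n → ℝ := fun t i => (⌊x i + t⌋ : ℝ)
    have hpR : ∀ t ∈ Set.Ioc (0 : ℝ) 1, p t ∈ (fun (x : Fin n → ℤ) (i : Fin n) => (x i : ℝ)) '' R :=
      fun t ht => ⟨_, ⟨hmem t, fun i => Int.floor_le_floor (by linarith [ht.1]), fun i => by
        dsimp only
        rw [← Int.floor_add_one]
        exact Int.floor_le_floor (by linarith [ht.2])⟩, rfl⟩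
    have hint : ∀ i, MeasureTheory.Integrable (fun t => p t i)
        (MeasureTheory.volume.restrict (Set.Ioc (0 : ℝ) 1)) := fun i => by
      refine MeasureTheory.Integrable.of_bound (C := |(⌊x i⌋ : ℝ)| + 1) ?_ ?_
      · have : Measurable fun t : ℝ => ((⌊x i + t⌋ : ℤ) : ℝ) := by fun_prop
        exact this.aestronglyMeasurable
      · filter_upwards [MeasureTheory.ae_restrict_mem measurableSet_Ioc] with t ht
        obtain ⟨v, ⟨-, hlo, hhi⟩, hv⟩ := hpR t ht
        have h1 : (⌊x i⌋ : ℝ) ≤ v i := by exact_mod_cast hlo i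
        have h2 : (v i : ℝ) ≤ ⌊x i⌋ + 1 := by exact_mod_cast hhi i
        rw [← hv, Real.norm_eq_abs, abs_le]
        constructor <;> cases abs_cases (⌊x i⌋ : ℝ) <;> linarith
    have hprob : MeasureTheory.IsProbabilityMeasure
        (MeasureTheory.volume.restrict (Set.Ioc (0 : ℝ) 1)) := ⟨by simp⟩
    have h := (convex_convexHull ℝ ((fun (x : Fin n → ℤ) (i : Fin n) => (x i : ℝ)) '' R)).integral_mem
      ((hR.image _).isClosed_convexHull (𝕜 := ℝ)) (f := p)
      (μ := MeasureTheory.volume.restrict (Set.Ioc (0 : ℝ) 1)) (by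
        filter_upwards [MeasureTheory.ae_restrict_mem measurableSet_Ioc] with t ht
        exact subset_convexHull _ _ (hpR t ht)) (MeasureTheory.Integrable.of_eval hint)
    have hx' : ∫ t in Set.Ioc (0 : ℝ) 1, p t = x := by
      ext i
      rw [MeasureTheory.eval_integral hint]
      exact integral_Ioc_floor_add (x i)
    rw [hx'] at h
    exact convexHull_mono (Set.image_mono Set.inter_subset_left) h

theorem isPolyOver_integerHull {S : Set (Fin n → ℤ)} (hS : IsLConvexSet S) :
    IsPolyOver (Rat.castHom ℝ).fieldRange (integerHull S) := by
  rw [integerHull_eq_of_isLConvexSet hS]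
  obtain ⟨s₀, hs₀⟩ := hS.1
  have h := IsPolyOver.iInter (F := (Rat.castHom ℝ).fieldRange) (P := fun p : Fin n × Fin n =>
    {x : Fin n → ℝ | ∀ γ : ℤ, (∀ s ∈ S, s p.1 - s p.2 ≤ γ) → x p.1 - x p.2 ≤ γ}) fun p => by
      -- Per pair, the least integer bound subsumes all the others; without a bound there is no
      -- constraint.
      by_cases hb : ∃ γ : ℤ, ∀ s ∈ S, s p.1 - s p.2 ≤ γ
      · obtain ⟨γ, hγ, hmin⟩ := Int.exists_least_of_bdd ⟨s₀ p.1 - s₀ p.2, fun γ hγ => hγ s₀ hs₀⟩ hb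
        convert IsPolyOver.halfspace (F := (Rat.castHom ℝ).fieldRange)
          (a := Pi.single p.1 1 - Pi.single p.2 1) (b := (γ : ℝ)) (fun i => ?_) (by simp) using 1
        · ext x
          simp only [sub_dotProduct, single_dotProduct, one_mul, Set.mem_ofPred_eq]
          exact ⟨fun h => h γ hγ, fun h γ' hγ' => h.trans (by exact_mod_cast hmin γ' hγ')⟩
        · refine sub_mem ?_ ?_ <;> rw [Pi.single_apply] <;> split_ifs <;>
            simp only [one_mem, zero_mem]
      · refine ⟨∅, Set.finite_empty, by simp, ?_⟩
        ext x
        simp only [Set.mem_ofPred_eq, Set.mem_empty_iff_false, false_imp_iff, implies_true, iff_true]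
        exact fun γ hγ => absurd ⟨γ, hγ⟩ hb
  convert h using 1
  ext x
  simp

theorem isLConvexPolyhedron_integerHull {S : Set (Fin n → ℤ)} (hS : IsLConvexSet S) :
    IsLConvexPolyhedron (integerHull S) := by
  refine ⟨(isPolyOver_integerHull hS).isRationalPolyhedron.isPolyhedron, ?_⟩
  rw [integerHull_eq_of_isLConvexSet hS]
  refine ⟨fun x hx y hy => ⟨fun i j γ h => ?_, fun i j γ h => ?_⟩, fun x hx μ i j γ h => ?_⟩
  · have h1 := hx i j γ h
    have h2 := hy i j γ h
    simp only [Pi.sup_apply, sub_le_iff_le_add]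
    refine sup_le ?_ ?_
    · linarith [le_sup_left (a := x j) (b := y j)]
    · linarith [le_sup_right (a := x j) (b := y j)]
  · have h1 := hx i j γ h
    have h2 := hy i j γ h
    simp only [Pi.inf_apply]
    rcases le_total (x j) (y j) with hle | hle
    · rw [inf_eq_left.2 hle]
      linarith [inf_le_left (a := x i) (b := y i)]
    · rw [inf_eq_right.2 hle]
      linarith [inf_le_right (a := x i) (b := y i)]
  · simpa using hx i j γ h

theorem integerHull_add (S T : Set (Fin n → ℤ)) :
    integerHull (S + T) = integerHull S + integerHull T := by
  let φ : (Fin n → ℤ) →+ (Fin n → ℝ) :=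
    { toFun := fun x i => x i, map_zero' := by ext; simp, map_add' := fun _ _ => by ext; simp }
  have h : φ '' (S + T) = φ '' S + φ '' T := Set.image_add φ
  change convexHull ℝ (φ '' (S + T)) = _
  rw [h, convexHull_add]
  rfl

/-- An L-convex polyhedron is L♮-convex. -/
theorem IsLConvexPolyhedron.isLNatConvexPolyhedron {P : Set (Fin n → ℝ)}
    (hP : IsLConvexPolyhedron P) : IsLNatConvexPolyhedron P := by
  obtain ⟨hpoly, hlat, hshift⟩ := hP
  -- The cylinder over P serves as `Q`.
  refine ⟨hpoly, {v | Fin.init v ∈ P}, ⟨?_, fun x hx y hy => hlat _ hx _ hy,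
    fun x hx μ => hshift _ hx μ⟩, ?_⟩
  · obtain ⟨m, A, b, rfl⟩ := hpoly
    refine ⟨m, fun i => Fin.snoc (A i) 0, b, ?_⟩
    ext v
    refine forall_congr' fun i => ?_
    simp [mulVec, dotProduct, Fin.sum_univ_castSucc, Fin.init]
  · ext x
    simp

theorem IsL2ConvexPolyhedron.isL2NatConvexPolyhedron {P : Set (Fin n → ℝ)}
    (hP : IsL2ConvexPolyhedron P) : IsL2NatConvexPolyhedron P := by
  obtain ⟨hpoly, P₁, P₂, h₁, h₂, hsum⟩ := hP
  exact ⟨hpoly, P₁, P₂, h₁.isLNatConvexPolyhedron, h₂.isLNatConvexPolyhedron, hsum⟩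

theorem IsL2ConvexSet.integerHull {S : Set (Fin n → ℤ)} (hS : IsL2ConvexSet S) :
    IsL2ConvexPolyhedron (integerHull S) ∧ IsRationalPolyhedron (integerHull S) := by
  obtain ⟨S₁, S₂, h₁, h₂, rfl⟩ := hS
  rw [integerHull_add]
  have hrat := ((isPolyOver_integerHull h₁).add (isPolyOver_integerHull h₂)).isRationalPolyhedron
  exact ⟨⟨hrat.isPolyhedron, _, _, isLConvexPolyhedron_integerHull h₁,
    isLConvexPolyhedron_integerHull h₂, rfl⟩, hrat⟩

end Polyhedra

theorem theorem3p3 (n : ℕ) :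
    (∀ P : Set (Fin n → ℝ), IsL2NatConvexPolyhedron P → IsRationalPolyhedron P →
      IsBoxTDIPolyhedron P) ∧
    (∀ P : Set (Fin n → ℝ), IsL2ConvexPolyhedron P →
      IsL2NatConvexPolyhedron P ∧ (IsRationalPolyhedron P → IsBoxTDIPolyhedron P)) ∧
    (∀ S : Set (Fin n → ℤ), IsL2ConvexSet S →
      IsL2ConvexPolyhedron (integerHull S) ∧ IsBoxTDIPolyhedron (integerHull S)) :=
  ⟨fun _ h hrat => h.isBoxTDIPolyhedron hrat,
    fun _ h => ⟨h.isL2NatConvexPolyhedron,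
      fun hrat => h.isL2NatConvexPolyhedron.isBoxTDIPolyhedron hrat⟩,
    fun _ h => ⟨h.integerHull.1,
      h.integerHull.1.isL2NatConvexPolyhedron.isBoxTDIPolyhedron h.integerHull.2⟩⟩
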